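/- Let $\mathbf{E}$ be a real Banach space and let $Q$ be a smooth manifold modelled on $\mathbf{E}$, equipped with a smooth weak Riemannian metric: each $\langle\cdot,\cdot\rangle_\eta$ is a continuous, symmetric, positive definite bilinear form on $T_\eta Q$, depending smoothly on $\eta$ and not required to induce the topology of $T_\eta Q$. Assume (1) $Q$ has a smooth Riemannian connection, i.e. a connector map $K: TTQ\to TQ$ which in charts reads $K(\eta,v,u,w)=(\eta,\,w+\Gamma(\eta)(v,u))$ with a smooth Christoffel map $\Gamma$ that is symmetric and satisfies $D_\eta\langle a,b\rangle_\eta\cdot c=\langle\Gamma(\eta)(c,a),b\rangle_\eta+\langle a,\Gamma(\eta)(c,b)\rangle_\eta$; (2) for every $\eta\in Q$ the inclusion $T_\eta Q\to T_\eta^*Q$, $v\mapsto\langle v,\cdot\rangle_\eta$, into the dual Banach space has dense range. Let $\tau: TQ\to Q$ and $\tau_1: TTQ\to TQ$ be the projections and $\Theta=(\tau_1,T\tau,K): TTQ\to TQ\oplus TQ\oplus TQ$, which is a diffeomorphism. For differentiable $H: TQ\to\mathbb{R}$ and $V,W\in T_\eta Q$ define the covariant partial derivatives $$\frac{\partial H}{\partial\eta}(V)\cdot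 W=dH\cdot\Theta^{-1}(V,W,0),\qquad \frac{\partial H}{\partial v}(V)\cdot W=dH\cdot\Theta^{-1}(V,0,W).$$ For $k\in\{0,1,2,\dots\}\cup\{\infty\}$ let $\mathcal{K}^k(TQ)$ be the algebra of all $f\in C^{k+1}(TQ,\mathbb{R})$ such that $\partial f/\partial\eta$ and $\partial f/\partial v$ are $C^k$ maps $TQ\to TQ$, in the sense that the covectors $\frac{\partial f}{\partial\eta}(V)$ and $\frac{\partial f}{\partial v}(V)$ are of the form $\langle Z(V),\cdot\rangle$ with $Z(V)\in T_{\tau(V)}Q$ and $Z: TQ\to TQ$ of class $C^k$; these covectors are then identified with the vectors $Z(V)$. Put $\mathcal{K}(TQ)=\mathcal{K}^\infty(TQ)$ and define, for $f,g\in\mathcal{K}^k(TQ)$, $$\{f,g\}(V)=\Big\langle\frac{\partial f}{\partial\eta}(V),\frac{\partial g}{\partial v}(V)\Big\rangle_{\tau(V)}-\Big\langle\frac{\partial f}{\partial v}(V),\frac{\partial g}{\partial\eta}(V)\Big\rangle_{\tau(V)} .$$ Then on every $\mathcal{K}^k(TQ)$, in particular on $\mathcal{K}(TQ)$, the bracket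 is antisymmetric, $\mathbb{R}$-bilinear and a derivation in each factor: $\{f_1f_2,g\}=f_1\{f_2,g\}+f_2\{f_1,g\}$ and $\{g,f_1f_2\}=f_1\{g,f_2\}+f_2\{g,f_1\}$. Moreover it maps $\mathcal{K}(TQ)\times\mathcal{K}(TQ)$ into $\mathcal{K}(TQ)$, satisfies the Jacobi identity there, and so makes $\mathcal{K}(TQ)$ a Lie algebra over $\mathbb{R}$. -/

import Mathlib

open Bundle
open scoped Manifold ContDiff Topology

noncomputable section

namespace WeakRiem

section Geometry

variable (E : Type*) [NormedAddCommGroup E] [NormedSpace ℝ E]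
  (Q : Type*) [TopologicalSpace Q] [ChartedSpace E Q] [IsManifold 𝓘(ℝ, E) ∞ Q]

/-- A smooth weak Riemannian metric on the manifold `Q` modelled on `E`: a smooth section
`q ↦ ⟨·,·⟩_q` of the bundle of continuous bilinear forms on the tangent spaces which is symmetric
and positive definite. The norm it defines on `T_q Q` need not induce the topology of `T_q Q`. -/
structure WeakRiemannianMetric where
  /-- the bilinear form `⟨·,·⟩_q` on `T_q Q` -/
  inner (q : Q) : TangentSpace 𝓘(ℝ, E) q →L[ℝ] TangentSpace 𝓘(ℝ, E) q →L[ℝ] ℝ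
  symm (q : Q) (v w : TangentSpace 𝓘(ℝ, E) q) : inner q v w = inner q w v
  pos (q : Q) (v : TangentSpace 𝓘(ℝ, E) q) : v ≠ 0 → 0 < inner q v v
  contMDiff : ContMDiff 𝓘(ℝ, E) (𝓘(ℝ, E).prod 𝓘(ℝ, E →L[ℝ] E →L[ℝ] ℝ)) ∞
    (fun q : Q ↦ TotalSpace.mk' (E →L[ℝ] E →L[ℝ] ℝ) q (inner q))

variable {E Q}

/-- For every `q`, the inclusion `T_q Q → T_q^* Q`, `v ↦ ⟨v, ·⟩_q`, has dense range in the
(strong, i.e. operator norm) topology of the dual. -/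
def WeakRiemannianMetric.DenseInclusion (g : WeakRiemannianMetric E Q) : Prop :=
  ∀ q : Q, DenseRange (fun v : TangentSpace 𝓘(ℝ, E) q ↦ g.inner q v)

/-- The metric read in the chart `φ` of `Q` around `q₀`:
`⟨a, b⟩_x = ⟨d(φ⁻¹)_x a, d(φ⁻¹)_x b⟩_{φ⁻¹ x}`. -/
def WeakRiemannianMetric.inChart (g : WeakRiemannianMetric E Q) (q₀ : Q) (x a b : E) : ℝ :=
  g.inner ((extChartAt 𝓘(ℝ, E) q₀).symm x)
    (mfderiv 𝓘(ℝ, E) 𝓘(ℝ, E) (extChartAt 𝓘(ℝ, E) q₀).symm x a)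
    (mfderiv 𝓘(ℝ, E) 𝓘(ℝ, E) (extChartAt 𝓘(ℝ, E) q₀).symm x b)

/-- The differential at `q` of the chart `φ` of `Q` around `q₀`, as a map into `E`. -/
def chartDeriv (q₀ q : Q) : TangentSpace 𝓘(ℝ, E) q →L[ℝ] E :=
  mfderiv 𝓘(ℝ, E) 𝓘(ℝ, E) (extChartAt 𝓘(ℝ, E) q₀) q

/-- The chart `(q, v) ↦ (φ q, dφ_q v)` of `TQ` induced by the chart `φ` of `Q` around `q₀`. -/
def tangentChart (q₀ : Q) (V : TangentBundle 𝓘(ℝ, E) Q) : E × E :=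
  (extChartAt 𝓘(ℝ, E) q₀ V.proj, chartDeriv q₀ V.proj V.2)

/-- The differential at `V` of the chart `tangentChart q₀` of `TQ`, as a map into `E × E`. -/
def tangentChartDeriv (q₀ : Q) (V : TangentBundle 𝓘(ℝ, E) Q) :
    TangentSpace 𝓘(ℝ, E).tangent V →L[ℝ] E × E :=
  mfderiv 𝓘(ℝ, E).tangent 𝓘(ℝ, E × E) (tangentChart q₀) V

/-- A smooth Riemannian connection for the weak Riemannian metric `g`, given by its connector map
`K : TTQ → TQ`, which in the chart of `Q` around `q₀` reads
`K (x, v, u, w) = (x, w + Γ(x)(v, u))` with a smooth Christoffel map `Γ` which is symmetric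
(no torsion) and compatible with the metric:
`D_x ⟨a, b⟩_x · c = ⟨Γ(x)(c, a), b⟩_x + ⟨a, Γ(x)(c, b)⟩_x`. -/
structure RiemannianConnection (g : WeakRiemannianMetric E Q) where
  /-- the connector map, on the fibre of `TTQ` over `V` -/
  connector (V : TangentBundle 𝓘(ℝ, E) Q) :
    TangentSpace 𝓘(ℝ, E).tangent V →L[ℝ] TangentSpace 𝓘(ℝ, E) V.proj
  /-- `christoffel q₀` is the Christoffel map in the chart of `Q` around `q₀` -/
  christoffel (q₀ : Q) : E → E →L[ℝ] E →L[ℝ] E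
  contDiffOn (q₀ : Q) : ContDiffOn ℝ ∞ (christoffel q₀) (extChartAt 𝓘(ℝ, E) q₀).target
  symm (q₀ : Q) : ∀ x ∈ (extChartAt 𝓘(ℝ, E) q₀).target, ∀ u v : E,
    christoffel q₀ x u v = christoffel q₀ x v u
  metric (q₀ : Q) : ∀ x ∈ (extChartAt 𝓘(ℝ, E) q₀).target, ∀ a b c : E,
    fderiv ℝ (fun y ↦ g.inChart q₀ y a b) x c =
      g.inChart q₀ x (christoffel q₀ x c a) b + g.inChart q₀ x a (christoffel q₀ x c b)
  connector_eq (q₀ : Q) (V : TangentBundle 𝓘(ℝ, E) Q) :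
    V.proj ∈ (extChartAt 𝓘(ℝ, E) q₀).source → ∀ Z : TangentSpace 𝓘(ℝ, E).tangent V,
      chartDeriv q₀ V.proj (connector V Z) = (tangentChartDeriv q₀ V Z).2 +
        christoffel q₀ (tangentChart q₀ V).1 (tangentChart q₀ V).2 (tangentChartDeriv q₀ V Z).1

/-- The map `Θ = (τ₁, Tτ, K) : TTQ → TQ ⊕ TQ ⊕ TQ` on the fibre of `TTQ` over `V`. -/
def Theta {g : WeakRiemannianMetric E Q} (C : RiemannianConnection g)
    (V : TangentBundle 𝓘(ℝ, E) Q) : TangentSpace 𝓘(ℝ, E).tangent V →L[ℝ]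
      TangentSpace 𝓘(ℝ, E) V.proj × TangentSpace 𝓘(ℝ, E) V.proj :=
  (mfderiv 𝓘(ℝ, E).tangent 𝓘(ℝ, E)
    (TotalSpace.proj : TangentBundle 𝓘(ℝ, E) Q → Q) V).prod (C.connector V)

/-- `tangentChart q₀` is the chart of `TQ` around `(q₀, 0)` in Mathlib's atlas. -/
theorem tangentChart_eq (q₀ : Q) (V : TangentBundle 𝓘(ℝ, E) Q)
    (hV : V.proj ∈ (extChartAt 𝓘(ℝ, E) q₀).source) :
    tangentChart q₀ V = extChartAt 𝓘(ℝ, E).tangent (⟨q₀, 0⟩ : TangentBundle 𝓘(ℝ, E) Q) V := by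
  rw [extChartAt_source] at hV
  have h := TangentBundle.continuousLinearMapAt_trivializationAt (I := 𝓘(ℝ, E)) hV
  have h2 : chartDeriv q₀ V.proj V.2 =
      (trivializationAt E (TangentSpace 𝓘(ℝ, E)) q₀).continuousLinearMapAt ℝ V.proj V.2 := by
    rw [h]; rfl
  unfold tangentChart
  rw [h2]
  rw [Trivialization.continuousLinearMapAt_apply, Trivialization.linearMapAt_apply]
  rw [if_pos (by simpa using hV)]
  rfl

theorem isInvertible_tangentChartDeriv (q₀ : Q) (V : TangentBundle 𝓘(ℝ, E) Q)
    (hV : V.proj ∈ (extChartAt 𝓘(ℝ, E) q₀).source) :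
    (tangentChartDeriv q₀ V).IsInvertible := by
  have ho : IsOpen {W : TangentBundle 𝓘(ℝ, E) Q | W.proj ∈ (extChartAt 𝓘(ℝ, E) q₀).source} :=
    (isOpen_extChartAt_source q₀).preimage (FiberBundle.continuous_proj E (TangentSpace 𝓘(ℝ, E)))
  have he : (tangentChart q₀ : TangentBundle 𝓘(ℝ, E) Q → E × E) =ᶠ[𝓝 V]
      extChartAt 𝓘(ℝ, E).tangent (⟨q₀, 0⟩ : TangentBundle 𝓘(ℝ, E) Q) :=
    Filter.eventually_of_mem (ho.mem_nhds hV) fun W hW ↦ tangentChart_eq q₀ W hW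
  have hs : V ∈ (extChartAt 𝓘(ℝ, E).tangent (⟨q₀, 0⟩ : TangentBundle 𝓘(ℝ, E) Q)).source := by
    rw [extChartAt_source] at hV ⊢
    exact (TangentBundle.mem_chart_source_iff _ _).2 hV
  have h := isInvertible_mfderiv_extChartAt (I := 𝓘(ℝ, E).tangent) hs
  have := he.mfderiv_eq (I := 𝓘(ℝ, E).tangent) (I' := 𝓘(ℝ, E × E))
  unfold tangentChartDeriv
  rw [this]
  exact h

theorem chartDeriv_mfderiv_proj (q₀ : Q) (V : TangentBundle 𝓘(ℝ, E) Q)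
    (hV : V.proj ∈ (extChartAt 𝓘(ℝ, E) q₀).source)
    (Z : TangentSpace 𝓘(ℝ, E).tangent V) :
    chartDeriv q₀ V.proj (mfderiv 𝓘(ℝ, E).tangent 𝓘(ℝ, E)
      (TotalSpace.proj : TangentBundle 𝓘(ℝ, E) Q → Q) V Z) = (tangentChartDeriv q₀ V Z).1 := by
  have hp : MDifferentiableAt 𝓘(ℝ, E).tangent 𝓘(ℝ, E)
      (TotalSpace.proj : TangentBundle 𝓘(ℝ, E) Q → Q) V :=
    (contMDiff_proj (n := 1) (TangentSpace 𝓘(ℝ, E))).mdifferentiable one_ne_zero V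
  have hc : MDifferentiableAt 𝓘(ℝ, E) 𝓘(ℝ, E) (extChartAt 𝓘(ℝ, E) q₀) V.proj :=
    mdifferentiableAt_extChartAt (by simpa using hV)
  have ho : IsOpen {W : TangentBundle 𝓘(ℝ, E) Q | W.proj ∈ (extChartAt 𝓘(ℝ, E) q₀).source} :=
    (isOpen_extChartAt_source q₀).preimage (FiberBundle.continuous_proj E (TangentSpace 𝓘(ℝ, E)))
  have he : (tangentChart q₀ : TangentBundle 𝓘(ℝ, E) Q → E × E) =ᶠ[𝓝 V]
      extChartAt 𝓘(ℝ, E).tangent (⟨q₀, 0⟩ : TangentBundle 𝓘(ℝ, E) Q) :=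
    Filter.eventually_of_mem (ho.mem_nhds hV) fun W hW ↦ tangentChart_eq q₀ W hW
  have ht : MDifferentiableAt 𝓘(ℝ, E).tangent 𝓘(ℝ, E × E)
      (tangentChart q₀ : TangentBundle 𝓘(ℝ, E) Q → E × E) V := by
    refine MDifferentiableAt.congr_of_eventuallyEq ?_ he
    refine mdifferentiableAt_extChartAt (I := 𝓘(ℝ, E).tangent) ?_
    exact (TangentBundle.mem_chart_source_iff _ _).2 (by simpa using hV)
  have hf : MDifferentiableAt 𝓘(ℝ, E × E) 𝓘(ℝ, E) (Prod.fst : E × E → E) (tangentChart q₀ V) :=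
    differentiableAt_fst.mdifferentiableAt
  have h1 := mfderiv_comp V hc hp
  have h2 := mfderiv_comp V hf ht
  have h3 : (extChartAt 𝓘(ℝ, E) q₀) ∘ (TotalSpace.proj : TangentBundle 𝓘(ℝ, E) Q → Q) =
    (Prod.fst : E × E → E) ∘ tangentChart q₀ := rfl
  have h4 := congrArg (fun L ↦ L Z) (h1.symm.trans (h3 ▸ h2))
  refine Eq.trans h4 ?_
  have h5 : mfderiv 𝓘(ℝ, E × E) 𝓘(ℝ, E) (Prod.fst : E × E → E) (tangentChart q₀ V) =
      ContinuousLinearMap.fst ℝ E E := by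
    rw [mfderiv_eq_fderiv, fderiv_fst]
  rw [h5]
  rfl

/-- `Θ` is a linear isomorphism on each fibre. -/
theorem isInvertible_Theta {g : WeakRiemannianMetric E Q} (C : RiemannianConnection g)
    (V : TangentBundle 𝓘(ℝ, E) Q) : (Theta C V).IsInvertible := by
  have hV : V.proj ∈ (extChartAt 𝓘(ℝ, E) V.proj).source := mem_extChartAt_source _
  obtain ⟨A, hA⟩ : (chartDeriv V.proj V.proj : TangentSpace 𝓘(ℝ, E) V.proj →L[ℝ] E).IsInvertible :=
    isInvertible_mfderiv_extChartAt hV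
  obtain ⟨B, hB⟩ := isInvertible_tangentChartDeriv V.proj V hV
  set G : E →L[ℝ] E := C.christoffel V.proj (tangentChart V.proj V).1 (tangentChart V.proj V).2
  have h1 : ∀ Z, A (Theta C V Z).1 = (B Z).1 := fun Z ↦ by
    have := chartDeriv_mfderiv_proj V.proj V hV Z
    rw [← hA, ← hB] at this
    exact this
  have h2 : ∀ Z, A (Theta C V Z).2 = (B Z).2 + G (B Z).1 := fun Z ↦ by
    have := C.connector_eq V.proj V hV Z
    rw [← hA, ← hB] at this
    exact this
  let A' : TangentSpace 𝓘(ℝ, E) V.proj →L[ℝ] E := A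
  let a := A' ∘L ContinuousLinearMap.fst ℝ _ (TangentSpace 𝓘(ℝ, E) V.proj)
  let b := A' ∘L ContinuousLinearMap.snd ℝ (TangentSpace 𝓘(ℝ, E) V.proj) _
  refine ContinuousLinearMap.IsInvertible.of_inverse
    (g := (B.symm : E × E →L[ℝ] _) ∘L (a.prod (b - G ∘L a))) ?_ ?_
  · refine ContinuousLinearMap.ext fun p ↦ Prod.ext (A.injective ?_) (A.injective ?_)
    · refine (h1 _).trans ?_
      simp [a, b, A']
    · refine (h2 _).trans ?_
      simp [a, b, A']
  · refine ContinuousLinearMap.ext fun Z ↦ B.injective ?_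
    have e1 : a (Theta C V Z) = (B Z).1 := h1 Z
    have e2 : b (Theta C V Z) = (B Z).2 + G (B Z).1 := h2 Z
    simp [e1, e2]

/-- The covariant partial derivative `∂H/∂η (V) · W = dH · Θ⁻¹(V, W, 0)`. -/
def covPartialBase {g : WeakRiemannianMetric E Q} (C : RiemannianConnection g)
    (H : TangentBundle 𝓘(ℝ, E) Q → ℝ) (V : TangentBundle 𝓘(ℝ, E) Q) :
    TangentSpace 𝓘(ℝ, E) V.proj →L[ℝ] ℝ :=
  (mfderiv 𝓘(ℝ, E).tangent 𝓘(ℝ, ℝ) H V : TangentSpace 𝓘(ℝ, E).tangent V →L[ℝ] ℝ) ∘L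
    (Theta C V).inverse ∘L ContinuousLinearMap.inl ℝ _ _

/-- The covariant partial derivative `∂H/∂v (V) · W = dH · Θ⁻¹(V, 0, W)`. -/
def covPartialFibre {g : WeakRiemannianMetric E Q} (C : RiemannianConnection g)
    (H : TangentBundle 𝓘(ℝ, E) Q → ℝ) (V : TangentBundle 𝓘(ℝ, E) Q) :
    TangentSpace 𝓘(ℝ, E) V.proj →L[ℝ] ℝ :=
  (mfderiv 𝓘(ℝ, E).tangent 𝓘(ℝ, ℝ) H V : TangentSpace 𝓘(ℝ, E).tangent V →L[ℝ] ℝ) ∘L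
    (Theta C V).inverse ∘L ContinuousLinearMap.inr ℝ _ _

/-- A field of covectors `A V ∈ T^*_{τ V} Q` along `τ : TQ → Q` is a `C^k` map `TQ → TQ`
(through the inclusions `T_q Q → T_q^* Q` given by the metric): there is a `C^k` map
`V ↦ (τ V, Z V)` with `A V · W = ⟨Z V, W⟩` for all `W`. -/
def IsContMDiffField (g : WeakRiemannianMetric E Q) (k : ℕ∞)
    (A : ∀ V : TangentBundle 𝓘(ℝ, E) Q, TangentSpace 𝓘(ℝ, E) V.proj →L[ℝ] ℝ) : Prop :=
  ∃ Z : ∀ V : TangentBundle 𝓘(ℝ, E) Q, TangentSpace 𝓘(ℝ, E) V.proj,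
    ContMDiff 𝓘(ℝ, E).tangent 𝓘(ℝ, E).tangent k
      (fun V ↦ (⟨V.proj, Z V⟩ : TangentBundle 𝓘(ℝ, E) Q)) ∧
    ∀ V W, A V W = g.inner V.proj (Z V) W

theorem contMDiff_smul_add_smul {k : ℕ∞} {a b : TangentBundle 𝓘(ℝ, E) Q → ℝ}
    {Y Z : ∀ V : TangentBundle 𝓘(ℝ, E) Q, TangentSpace 𝓘(ℝ, E) V.proj}
    (ha : ContMDiff 𝓘(ℝ, E).tangent 𝓘(ℝ, ℝ) k a) (hb : ContMDiff 𝓘(ℝ, E).tangent 𝓘(ℝ, ℝ) k b)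
    (hY : ContMDiff 𝓘(ℝ, E).tangent 𝓘(ℝ, E).tangent k
      (fun V ↦ (⟨V.proj, Y V⟩ : TangentBundle 𝓘(ℝ, E) Q)))
    (hZ : ContMDiff 𝓘(ℝ, E).tangent 𝓘(ℝ, E).tangent k
      (fun V ↦ (⟨V.proj, Z V⟩ : TangentBundle 𝓘(ℝ, E) Q))) :
    ContMDiff 𝓘(ℝ, E).tangent 𝓘(ℝ, E).tangent k
      (fun V ↦ (⟨V.proj, a V • Y V + b V • Z V⟩ : TangentBundle 𝓘(ℝ, E) Q)) := by
  intro V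
  have h1 := (contMDiffAt_totalSpace (f := fun V : TangentBundle 𝓘(ℝ, E) Q ↦
    (⟨V.proj, Y V⟩ : TangentBundle 𝓘(ℝ, E) Q))).1 (hY V)
  have h2 := (contMDiffAt_totalSpace (f := fun V : TangentBundle 𝓘(ℝ, E) Q ↦
    (⟨V.proj, Z V⟩ : TangentBundle 𝓘(ℝ, E) Q))).1 (hZ V)
  refine (contMDiffAt_totalSpace (f := fun V : TangentBundle 𝓘(ℝ, E) Q ↦
    (⟨V.proj, a V • Y V + b V • Z V⟩ : TangentBundle 𝓘(ℝ, E) Q))).2 ⟨h1.1, ?_⟩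
  refine (((ha V).smul h1.2).add ((hb V).smul h2.2)).congr_of_eventuallyEq ?_
  have ho : IsOpen {W : TangentBundle 𝓘(ℝ, E) Q |
      W.proj ∈ (trivializationAt E (TangentSpace 𝓘(ℝ, E)) V.proj).baseSet} :=
    (trivializationAt E (TangentSpace 𝓘(ℝ, E)) V.proj).open_baseSet.preimage
      (FiberBundle.continuous_proj E (TangentSpace 𝓘(ℝ, E)))
  refine Filter.eventually_of_mem
    (ho.mem_nhds (mem_baseSet_trivializationAt E (TangentSpace 𝓘(ℝ, E)) V.proj)) fun W hW ↦ ?_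
  have hl := (trivializationAt E (TangentSpace 𝓘(ℝ, E)) V.proj).linear ℝ hW
  change ((trivializationAt E (TangentSpace 𝓘(ℝ, E)) V.proj) ⟨W.proj, _⟩).2 = _
  rw [hl.map_add, hl.map_smul, hl.map_smul]
  rfl

theorem IsContMDiffField.smul_add_smul {g : WeakRiemannianMetric E Q} {k : ℕ∞}
    {a b : TangentBundle 𝓘(ℝ, E) Q → ℝ}
    {A B : ∀ V : TangentBundle 𝓘(ℝ, E) Q, TangentSpace 𝓘(ℝ, E) V.proj →L[ℝ] ℝ}
    (ha : ContMDiff 𝓘(ℝ, E).tangent 𝓘(ℝ, ℝ) k a) (hb : ContMDiff 𝓘(ℝ, E).tangent 𝓘(ℝ, ℝ) k b)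
    (hA : IsContMDiffField g k A) (hB : IsContMDiffField g k B) :
    IsContMDiffField g k (fun V ↦ a V • A V + b V • B V) := by
  obtain ⟨Y, hY, hY'⟩ := hA
  obtain ⟨Z, hZ, hZ'⟩ := hB
  exact ⟨_, contMDiff_smul_add_smul ha hb hY hZ, fun V W ↦ by simp [hY', hZ']⟩

/-- The class `𝒦^k(TQ)` of the `C^{k+1}` functions `f : TQ → ℝ` for which `∂f/∂η` and `∂f/∂v` are
`C^k` maps `TQ → TQ`, a subalgebra of the algebra of functions on `TQ`. -/
def classK {g : WeakRiemannianMetric E Q} (C : RiemannianConnection g) (k : ℕ∞) :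
    Subalgebra ℝ (TangentBundle 𝓘(ℝ, E) Q → ℝ) where
  carrier := {f | ContMDiff 𝓘(ℝ, E).tangent 𝓘(ℝ, ℝ) (k + 1) f ∧
    IsContMDiffField g k (covPartialBase C f) ∧ IsContMDiffField g k (covPartialFibre C f)}
  add_mem' {f h} hf hh := by
    have hd : ∀ V, _ := fun V ↦ mfderiv_add (hf.1.mdifferentiable (by simp) V)
      (hh.1.mdifferentiable (by simp) V)
    refine ⟨hf.1.add hh.1, ?_, ?_⟩
    · convert IsContMDiffField.smul_add_smul contMDiff_const contMDiff_const hf.2.1 hh.2.1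
        (a := fun _ ↦ 1) (b := fun _ ↦ 1) using 2 with V
      ext W
      simp only [covPartialBase, hd, one_smul]
      rfl
    · convert IsContMDiffField.smul_add_smul contMDiff_const contMDiff_const hf.2.2 hh.2.2
        (a := fun _ ↦ 1) (b := fun _ ↦ 1) using 2 with V
      ext W
      simp only [covPartialFibre, hd, one_smul]
      rfl
  mul_mem' {f h} hf hh := by
    have hd : ∀ V, _ := fun V ↦ ((hf.1.mdifferentiable (by simp) V).hasMFDerivAt.mul
      (hh.1.mdifferentiable (by simp) V).hasMFDerivAt).mfderiv
    have hfk := hf.1.of_le le_self_add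
    have hhk := hh.1.of_le le_self_add
    refine ⟨hf.1.mul hh.1, ?_, ?_⟩
    · convert IsContMDiffField.smul_add_smul hfk hhk hh.2.1 hf.2.1 using 2 with V
      ext W
      simp only [covPartialBase, hd]
      rfl
    · convert IsContMDiffField.smul_add_smul hfk hhk hh.2.2 hf.2.2 using 2 with V
      ext W
      simp only [covPartialFibre, hd]
      rfl
  algebraMap_mem' r := by
    have hd : ∀ V, mfderiv 𝓘(ℝ, E).tangent 𝓘(ℝ, ℝ)
        (algebraMap ℝ (TangentBundle 𝓘(ℝ, E) Q → ℝ) r) V = 0 := fun V ↦ mfderiv_const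
    have h0 : ContMDiff 𝓘(ℝ, E).tangent 𝓘(ℝ, E).tangent k
        (fun V : TangentBundle 𝓘(ℝ, E) Q ↦ (⟨V.proj, 0⟩ : TangentBundle 𝓘(ℝ, E) Q)) :=
      (contMDiff_zeroSection ℝ (TangentSpace 𝓘(ℝ, E))).comp
        (contMDiff_proj (TangentSpace 𝓘(ℝ, E)))
    refine ⟨contMDiff_const, ⟨fun V ↦ 0, h0, fun V W ↦ ?_⟩, ⟨fun V ↦ 0, h0, fun V W ↦ ?_⟩⟩
    · simp only [covPartialBase, hd, map_zero, zero_apply]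
      rfl
    · simp only [covPartialFibre, hd, map_zero, zero_apply]
      rfl

open Classical in
/-- The vector `Z ∈ T_q Q` with `⟨Z, ·⟩_q = A`; it is unique, and set to `0` if there is none. -/
def WeakRiemannianMetric.sharp (g : WeakRiemannianMetric E Q) (q : Q)
    (A : TangentSpace 𝓘(ℝ, E) q →L[ℝ] ℝ) : TangentSpace 𝓘(ℝ, E) q :=
  if h : ∃ Z, g.inner q Z = A then h.choose else 0

/-- The bracket
`{f, g}(V) = ⟨∂f/∂η (V), ∂g/∂v (V)⟩ - ⟨∂f/∂v (V), ∂g/∂η (V)⟩` of functions on `TQ`, with the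
covariant partial derivatives regarded as tangent vectors by means of the metric `m`. -/
def poissonBracket {m : WeakRiemannianMetric E Q} (C : RiemannianConnection m)
    (f g : TangentBundle 𝓘(ℝ, E) Q → ℝ) : TangentBundle 𝓘(ℝ, E) Q → ℝ := fun V ↦
  m.inner V.proj (m.sharp V.proj (covPartialBase C f V)) (m.sharp V.proj (covPartialFibre C g V)) -
  m.inner V.proj (m.sharp V.proj (covPartialFibre C f V)) (m.sharp V.proj (covPartialBase C g V))

end Geometry

end WeakRiem

end

/-! In a chart of `TQ`, put `θ = ⟨v, dx⟩_x` and `Ω = dθ` (`localForm`). Metric compatibility and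
symmetry of `Γ` give `Ω(a, b) = ⟨K a, b₁⟩ - ⟨a₁, K b⟩`, where `a₁` is the horizontal component and
`K a = a₂ + Γ(v, a₁)` the vertical one (`extDerivOne_canonicalForm`). Hence the covariant partial
derivatives of `f` are represented by vectors `x`, `y` exactly when `df = -Ω(X_f, ·)` for the field
`X_f` with horizontal part `y` and vertical part `-x` (`represents_iff`), and the bracket is `{f, g}
= df(X_g)`.

The metric is weak, so `Ω` is only weakly nondegenerate: a Hamiltonian field is unique if it exists,
but it need not exist. The class `𝒦(TQ)` consists of the smooth functions that have a smooth one in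
every chart. Closure under the bracket therefore requires a field for `{f, g}`, and since `Ω` is
closed the commutator `DX_f · X_g - DX_g · X_f` is one (`IsHamiltonianAt.fderiv_bracket`). The
Jacobi identity follows from `dΩ = 0` and the symmetry of second derivatives
(`IsHamiltonianAt.jacobi`). The remaining identities are pointwise consequences of linearity and the
Leibniz rule for the differential. -/

noncomputable section

namespace WeakRiem

set_option maxSynthPendingDepth 3

/-! ### Hamiltonian fields of a closed two-form on a normed space. -/

section SymplecticCalculus

variable {F : Type*} [NormedAddCommGroup F] [NormedSpace ℝ F]

/-- `X` is, near `p`, the Hamiltonian vector field of `f` for the two-form `Ω`, up to sign. -/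
def IsHamiltonianAt (Ω : F → F →L[ℝ] F →L[ℝ] ℝ) (f : F → ℝ) (X : F → F) (p : F) : Prop :=
  ∀ᶠ q in 𝓝 p, fderiv ℝ f q = -Ω q (X q)

theorem _root_.HasFDerivAt.apply_apply {Ω : F → F →L[ℝ] F →L[ℝ] ℝ} {Ω' : F →L[ℝ] F →L[ℝ] F →L[ℝ] ℝ}
    {p : F} (hΩ : HasFDerivAt Ω Ω' p) (b c : F) :
    HasFDerivAt (fun q ↦ Ω q b c) ((Ω'.flip b).flip c) p := by
  have h := (hΩ.clm_apply (hasFDerivAt_const b p)).clm_apply (hasFDerivAt_const c p)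
  simpa using h

variable {Ω : F → F →L[ℝ] F →L[ℝ] ℝ} {f g h : F → ℝ} {X Y Z : F → F} {p : F}

/-- Differentiate `df = -Ω(X)` by the product rule; this is why `IsHamiltonianAt` asks for the
equation near `p` and not only at `p`. -/
theorem IsHamiltonianAt.fderiv_fderiv (hf : IsHamiltonianAt Ω f X p)
    (hΩ : DifferentiableAt ℝ Ω p) (hX : DifferentiableAt ℝ X p) (a b : F) :
    fderiv ℝ (fderiv ℝ f) p a b = -(fderiv ℝ Ω p a (X p) b + Ω p (fderiv ℝ X p a) b) := by
  have h1 : HasFDerivAt (fun q ↦ -Ω q (X q)) _ p := (hΩ.hasFDerivAt.clm_apply hX.hasFDerivAt).neg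
  have h2 : fderiv ℝ f =ᶠ[𝓝 p] fun q ↦ -Ω q (X q) := hf
  rw [h2.fderiv_eq, h1.fderiv]
  simp [add_comm]

theorem fderiv_fderiv_apply_vectorField (hf : DifferentiableAt ℝ (fderiv ℝ f) p)
    (hY : DifferentiableAt ℝ Y p) (c : F) :
    fderiv ℝ (fun q ↦ fderiv ℝ f q (Y q)) p c =
      fderiv ℝ (fderiv ℝ f) p c (Y p) + fderiv ℝ f p (fderiv ℝ Y p c) := by
  rw [(hf.hasFDerivAt.clm_apply hY.hasFDerivAt).fderiv]
  simp [add_comm]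

/-- The derivative of the bracket of two functions is represented by the Lie bracket of their
Hamiltonian vector fields. -/
theorem IsHamiltonianAt.fderiv_bracket (hf : IsHamiltonianAt Ω f X p)
    (hg : IsHamiltonianAt Ω g Y p) (hΩ : DifferentiableAt ℝ Ω p)
    (hX : DifferentiableAt ℝ X p) (hY : DifferentiableAt ℝ Y p)
    (hf2 : ContDiffAt ℝ 2 f p) (hg2 : ContDiffAt ℝ 2 g p)
    (halt : ∀ᶠ q in 𝓝 p, ∀ a b, Ω q a b = -Ω q b a)
    (hcl : ∀ a b c, fderiv ℝ Ω p a b c + fderiv ℝ Ω p b c a + fderiv ℝ Ω p c a b = 0) :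
    fderiv ℝ (fun q ↦ fderiv ℝ f q (Y q)) p = -Ω p (fderiv ℝ X p (Y p) - fderiv ℝ Y p (X p)) := by
  have hs : IsSymmSndFDerivAt ℝ f p := hf2.isSymmSndFDerivAt (by simp)
  have hs' : IsSymmSndFDerivAt ℝ g p := hg2.isSymmSndFDerivAt (by simp)
  -- Antisymmetry holds near `p`, so it passes to the derivative of `Ω` in the last two slots.
  have hd : ∀ a b c, fderiv ℝ Ω p a b c = -fderiv ℝ Ω p a c b := fun a b c ↦ by
    have e : (fun q ↦ Ω q b c) =ᶠ[𝓝 p] fun q ↦ -Ω q c b := halt.mono fun q hq ↦ hq b c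
    have e1 := e.fderiv_eq (𝕜 := ℝ)
    rw [(hΩ.hasFDerivAt.apply_apply b c).fderiv,
      (hΩ.hasFDerivAt.apply_apply c b).fun_neg.fderiv] at e1
    simpa using congrArg (fun L : F →L[ℝ] ℝ ↦ L a) e1
  have ha := halt.self_of_nhds
  ext c
  rw [fderiv_fderiv_apply_vectorField ((hf2.fderiv_right (m := 1) le_rfl).differentiableAt
    one_ne_zero) hY, hs c (Y p), hf.fderiv_fderiv hΩ hX, hf.self_of_nhds]
  -- Symmetry of `D²g` trades `Ω(X, DY c)` for `-Ω(DY X, c)` plus derivatives of `Ω`; together with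
  -- the one coming from `D²f` these form the cyclic sum, which vanishes.
  have e1 := hg.fderiv_fderiv hΩ hY c (X p)
  have e2 := hg.fderiv_fderiv hΩ hY (X p) c
  have e3 := hs' c (X p)
  have e4 := hcl (X p) (Y p) c
  have e5 := hd (Y p) (X p) c
  have e6 := hd c (X p) (Y p)
  have e7 := ha (X p) (fderiv ℝ Y p c)
  simp only [neg_apply, map_sub, sub_apply]
  linarith

/-- The Jacobi identity for the bracket of a closed two-form. -/
theorem IsHamiltonianAt.jacobi (hf : IsHamiltonianAt Ω f X p)
    (hg : IsHamiltonianAt Ω g Y p) (hh : IsHamiltonianAt Ω h Z p) (hΩ : DifferentiableAt ℝ Ω p)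
    (hX : DifferentiableAt ℝ X p) (hY : DifferentiableAt ℝ Y p) (hZ : DifferentiableAt ℝ Z p)
    (hf2 : ContDiffAt ℝ 2 f p) (hg2 : ContDiffAt ℝ 2 g p) (hh2 : ContDiffAt ℝ 2 h p)
    (halt : ∀ᶠ q in 𝓝 p, ∀ a b, Ω q a b = -Ω q b a)
    (hcl : ∀ a b c, fderiv ℝ Ω p a b c + fderiv ℝ Ω p b c a + fderiv ℝ Ω p c a b = 0) :
    fderiv ℝ (fun q ↦ fderiv ℝ f q (Y q)) p (Z p) + fderiv ℝ (fun q ↦ fderiv ℝ g q (Z q)) p (X p) +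
      fderiv ℝ (fun q ↦ fderiv ℝ h q (X q)) p (Y p) = 0 := by
  have hs : ∀ {f : F → ℝ}, ContDiffAt ℝ 2 f p → ∀ a b, fderiv ℝ (fderiv ℝ f) p a b =
      fderiv ℝ (fderiv ℝ f) p b a := fun hf ↦ hf.isSymmSndFDerivAt (by simp)
  have hd : ∀ {f : F → ℝ}, ContDiffAt ℝ 2 f p → DifferentiableAt ℝ (fderiv ℝ f) p := fun hf ↦
    (hf.fderiv_right (m := 1) le_rfl).differentiableAt one_ne_zero
  have ha := halt.self_of_nhds
  rw [fderiv_fderiv_apply_vectorField (hd hf2) hY, fderiv_fderiv_apply_vectorField (hd hg2) hZ,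
    fderiv_fderiv_apply_vectorField (hd hh2) hX, hf.self_of_nhds, hg.self_of_nhds,
    hh.self_of_nhds]
  simp only [neg_apply]
  -- Now `df(DY Z)` reads `Ω(DY Z, X)` and cancels against the same term in `D²g(Z, X)`, and
  -- cyclically. Only the cyclic sum of derivatives of `Ω` is left.
  rw [ha (X p), ha (Y p), ha (Z p)]
  have e1 := hf.fderiv_fderiv hΩ hX (Y p) (Z p)
  have e2 := hg.fderiv_fderiv hΩ hY (Z p) (X p)
  have e3 := hh.fderiv_fderiv hΩ hZ (X p) (Y p)
  have e4 := hcl (X p) (Z p) (Y p)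
  have e4' := hcl (X p) (Y p) (Z p)
  have f1 := hs hf2 (Y p) (Z p)
  have f2 := hs hg2 (Z p) (X p)
  have f3 := hs hh2 (X p) (Y p)
  linarith

/-- The exterior derivative of a one-form. -/
def extDerivOne (θ : F → F →L[ℝ] ℝ) (p : F) : F →L[ℝ] F →L[ℝ] ℝ :=
  fderiv ℝ θ p - ContinuousLinearMap.flip (fderiv ℝ θ p)

variable {θ : F → F →L[ℝ] ℝ}

theorem extDerivOne_antisymm (θ : F → F →L[ℝ] ℝ) (p a b : F) :
    extDerivOne θ p a b = -extDerivOne θ p b a := by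
  simp [extDerivOne]

theorem contDiffAt_extDerivOne (h : ContDiffAt ℝ ∞ θ p) : ContDiffAt ℝ ∞ (extDerivOne θ) p := by
  have h1 : ContDiffAt ℝ ∞ (fderiv ℝ θ) p := h.fderiv_right (m := ∞) (by simp)
  have h2 : ContDiff ℝ ∞ (fun L : F →L[ℝ] F →L[ℝ] ℝ ↦ L.flip) :=
    (ContinuousLinearMap.flipₗᵢ ℝ F F ℝ).contDiff
  exact h1.sub (h2.contDiffAt.comp p h1)

/-- This is `d² = 0`: the six second derivatives of `θ` cancel in pairs by symmetry. -/
theorem extDerivOne_closed (h : ContDiffAt ℝ ∞ θ p) (a b c : F) :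
    fderiv ℝ (extDerivOne θ) p a b c + fderiv ℝ (extDerivOne θ) p b c a +
      fderiv ℝ (extDerivOne θ) p c a b = 0 := by
  have hd := (((h.fderiv_right (m := ∞) (by simp)).differentiableAt (by simp)).hasFDerivAt :
    HasFDerivAt (fderiv ℝ θ) _ p)
  have hs : IsSymmSndFDerivAt ℝ θ p :=
    h.isSymmSndFDerivAt (by simpa using ENat.LEInfty.out)
  have e1 : ∀ b c, HasFDerivAt (fun q ↦ extDerivOne θ q b c) _ p := fun b c ↦
    (hd.apply_apply b c).fun_sub (hd.apply_apply c b)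
  have he : HasFDerivAt (extDerivOne θ) _ p :=
    ((contDiffAt_extDerivOne h).differentiableAt (by simp)).hasFDerivAt
  have e2 : ∀ a b c, fderiv ℝ (extDerivOne θ) p a b c =
      fderiv ℝ (fderiv ℝ θ) p a b c - fderiv ℝ (fderiv ℝ θ) p a c b := fun a b c ↦ by
    simpa using congrArg (fun L ↦ L a) ((he.apply_apply b c).unique (e1 b c))
  rw [e2, e2, e2, hs a b, hs a c, hs b c]
  ring

end SymplecticCalculus

/-! ### The canonical one-form of a metric on the model space. -/

section LocalForm

variable {E : Type*} [NormedAddCommGroup E] [NormedSpace ℝ E]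

/-- The canonical one-form `(x, v) ↦ ⟨v, dx⟩_x` of a field of bilinear forms on `E`. -/
def canonicalForm (G : E → E →L[ℝ] E →L[ℝ] ℝ) (p : E × E) : E × E →L[ℝ] ℝ :=
  ContinuousLinearMap.precomp ℝ (ContinuousLinearMap.fst ℝ E E) (G p.1 p.2)

variable {G : E → E →L[ℝ] E →L[ℝ] ℝ} {p : E × E}

theorem contDiffAt_canonicalForm (hG : ContDiffAt ℝ ∞ G p.1) :
    ContDiffAt ℝ ∞ (canonicalForm G) p := by
  have h : ContDiffAt ℝ ∞ (fun p : E × E ↦ G p.1 p.2) p :=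
    (hG.comp p contDiffAt_fst).clm_apply contDiffAt_snd
  exact (ContinuousLinearMap.contDiff _).contDiffAt.comp p h

/-- The two-form of a metric in terms of the horizontal and vertical components of vectors. -/
theorem extDerivOne_canonicalForm {Γ : E →L[ℝ] E →L[ℝ] E} (hG : DifferentiableAt ℝ G p.1)
    (hsymm : ∀ a b, G p.1 a b = G p.1 b a) (hΓ : ∀ a b, Γ a b = Γ b a)
    (hm : ∀ a b c, fderiv ℝ (fun y ↦ G y a b) p.1 c = G p.1 (Γ c a) b + G p.1 a (Γ c b))
    (a b : E × E) :
    extDerivOne (canonicalForm G) p a b =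
      G p.1 (a.2 + Γ p.2 a.1) b.1 - G p.1 a.1 (b.2 + Γ p.2 b.1) := by
  have hGd : HasFDerivAt G _ p.1 := hG.hasFDerivAt
  have hm' : ∀ a b c, fderiv ℝ G p.1 c a b = G p.1 (Γ c a) b + G p.1 a (Γ c b) := fun a b c ↦ by
    rw [← hm, (hGd.apply_apply a b).fderiv]
    simp
  have e : ∀ a b, fderiv ℝ (canonicalForm G) p a b =
      fderiv ℝ G p.1 a.1 p.2 b.1 + G p.1 a.2 b.1 := fun a b ↦ by
    have h1 : HasFDerivAt (fun p : E × E ↦ G p.1 p.2) _ p :=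
      (hGd.comp p hasFDerivAt_fst).clm_apply hasFDerivAt_snd
    have h2 : HasFDerivAt (canonicalForm G) _ p :=
      (ContinuousLinearMap.precomp ℝ (ContinuousLinearMap.fst ℝ E E)).hasFDerivAt.comp p h1
    rw [h2.fderiv]
    simp [add_comm]
  -- Compatibility turns the derivative of `G` into Christoffel terms. The two terms `⟨v, Γ(a₁,
  -- b₁)⟩` and `⟨v, Γ(b₁, a₁)⟩` cancel because `Γ` is symmetric.
  simp only [extDerivOne, sub_apply, ContinuousLinearMap.flip_apply, e, hm', map_add, add_apply]
  rw [hΓ p.2, hΓ p.2, hΓ b.1 a.1, hsymm (Γ b.1 p.2), hsymm b.2 a.1]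
  ring

end LocalForm

end WeakRiem

end

noncomputable section

namespace WeakRiem

/-! ### The metric and functions on `TQ` read in charts. -/

section LocalReading

variable {E : Type*} [NormedAddCommGroup E] [NormedSpace ℝ E]
  {Q : Type*} [TopologicalSpace Q] [ChartedSpace E Q] [IsManifold 𝓘(ℝ, E) ∞ Q]

/-- The differential of the inverse of the chart of `Q` around `q₀`. -/
def chartSymmDeriv (q₀ : Q) (x : E) :
    E →L[ℝ] TangentSpace 𝓘(ℝ, E) ((extChartAt 𝓘(ℝ, E) q₀).symm x) :=
  mfderiv 𝓘(ℝ, E) 𝓘(ℝ, E) (extChartAt 𝓘(ℝ, E) q₀).symm x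

theorem chartSymmDeriv_chartDeriv {q₀ : Q} {x : E} (hx : x ∈ (extChartAt 𝓘(ℝ, E) q₀).target)
    (a : TangentSpace 𝓘(ℝ, E) ((extChartAt 𝓘(ℝ, E) q₀).symm x)) :
    chartSymmDeriv q₀ x (chartDeriv q₀ _ a) = a := by
  have h := mfderivWithin_extChartAt_symm_comp_mfderiv_extChartAt (I := 𝓘(ℝ, E)) hx
  rw [modelWithCornersSelf_coe, Set.range_id, mfderivWithin_univ] at h
  exact congrArg (fun L : E →L[ℝ] E ↦ L a) h

theorem chartDeriv_eq_trivializationAt {q₀ q : Q} (hq : q ∈ (extChartAt 𝓘(ℝ, E) q₀).source)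
    (a : TangentSpace 𝓘(ℝ, E) q) :
    chartDeriv q₀ q a = (trivializationAt E (TangentSpace 𝓘(ℝ, E)) q₀ ⟨q, a⟩).2 := by
  have h := tangentChart_eq q₀ (⟨q, a⟩ : TangentBundle 𝓘(ℝ, E) Q) hq
  exact congrArg Prod.snd h

theorem exists_chartDeriv_eq {q₀ q : Q} (hq : q ∈ (extChartAt 𝓘(ℝ, E) q₀).source) (a : E) :
    ∃ v, chartDeriv q₀ q v = a := by
  obtain ⟨A, hA⟩ : (chartDeriv q₀ q : TangentSpace 𝓘(ℝ, E) q →L[ℝ] E).IsInvertible :=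
    isInvertible_mfderiv_extChartAt hq
  exact ⟨A.symm a, by rw [← hA]; exact A.apply_symm_apply a⟩

/-- The metric read in the chart of `Q` around `q₀`, as a field of bilinear forms on `E`. -/
def localMetric (m : WeakRiemannianMetric E Q) (q₀ : Q) (x : E) : E →L[ℝ] E →L[ℝ] ℝ :=
  ContinuousLinearMap.precomp ℝ (chartSymmDeriv q₀ x) ∘L
    m.inner ((extChartAt 𝓘(ℝ, E) q₀).symm x) ∘L chartSymmDeriv q₀ x

theorem localMetric_chartDeriv (m : WeakRiemannianMetric E Q) {q₀ q : Q}
    (hq : q ∈ (extChartAt 𝓘(ℝ, E) q₀).source) (a b : TangentSpace 𝓘(ℝ, E) q) :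
    localMetric m q₀ (extChartAt 𝓘(ℝ, E) q₀ q) (chartDeriv q₀ q a) (chartDeriv q₀ q b) =
      m.inner q a b := by
  -- Over a point of the form `φ.symm x` the tangent spaces match definitionally; general `q`
  -- follows by rewriting the whole statement along `left_inv`, without transporting vectors.
  have key : ∀ x ∈ (extChartAt 𝓘(ℝ, E) q₀).target,
      ∀ a b : TangentSpace 𝓘(ℝ, E) ((extChartAt 𝓘(ℝ, E) q₀).symm x),
      localMetric m q₀ x (chartDeriv q₀ _ a) (chartDeriv q₀ _ b) = m.inner _ a b := by
    intro x hx a b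
    change m.inner _ (chartSymmDeriv q₀ x _) (chartSymmDeriv q₀ x _) = _
    rw [chartSymmDeriv_chartDeriv hx, chartSymmDeriv_chartDeriv hx]
  have h := key _ ((extChartAt 𝓘(ℝ, E) q₀).map_source hq)
  rw [(extChartAt 𝓘(ℝ, E) q₀).left_inv hq] at h
  exact h a b

/-- The metric is a smooth section of a bundle of bilinear forms, whose trivialization is built from
that of `TQ`; the inverse of the latter is the derivative of the inverse chart, so the section's
coordinates are `localMetric`. -/
theorem contDiffAt_localMetric (m : WeakRiemannianMetric E Q) {q₀ : Q} {x : E}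
    (hx : x ∈ (extChartAt 𝓘(ℝ, E) q₀).target) : ContDiffAt ℝ ∞ (localMetric m q₀) x := by
  set φ := extChartAt 𝓘(ℝ, E) q₀ with hφ
  have hq : φ.symm x ∈ φ.source := φ.map_target hx
  have hb : ∀ q ∈ φ.source, q ∈ (trivializationAt E (TangentSpace 𝓘(ℝ, E)) q₀).baseSet :=
    fun q hq ↦ by simpa [hφ] using hq
  have h1 := ((trivializationAt (E →L[ℝ] E →L[ℝ] ℝ)
    (fun q : Q ↦ TangentSpace 𝓘(ℝ, E) q →L[ℝ] TangentSpace 𝓘(ℝ, E) q →L[ℝ] ℝ)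
      q₀).contMDiffAt_section_iff (n := ∞) (IB := 𝓘(ℝ, E)) (s := m.inner) (x₀ := φ.symm x)
      (by simpa using hb _ hq)).1 (m.contMDiff _)
  simp only [hom_trivializationAt_apply] at h1
  have h2 := h1.comp x ((contMDiffOn_extChartAt_symm (n := ∞) (I := 𝓘(ℝ, E)) q₀).contMDiffAt
    ((isOpen_extChartAt_target q₀).mem_nhds hx))
  refine h2.contDiffAt.congr_of_eventuallyEq ?_
  filter_upwards [(isOpen_extChartAt_target q₀).mem_nhds hx] with y hy
  ext a b
  have hy' := hb _ (φ.map_target hy)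
  rw [Function.comp_apply, inCoordinates_apply_eq₂ hy' hy' (by simp)]
  have hs : ∀ a : E, (trivializationAt E (TangentSpace 𝓘(ℝ, E)) q₀).symm (φ.symm y) a =
      chartSymmDeriv q₀ y a := fun a ↦ by
    have h3 := TangentBundle.symmL_trivializationAt (I := 𝓘(ℝ, E)) (x₀ := q₀) (x := φ.symm y)
      (by simpa [hφ] using φ.map_target hy)
    rw [modelWithCornersSelf_coe, Set.range_id, mfderivWithin_univ] at h3
    have h5 := congrArg (fun L : E →L[ℝ] E ↦ L a) h3
    rw [φ.right_inv hy] at h5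
    exact (Trivialization.symmL_apply _ hy' a).symm.trans h5
  rw [hs, hs]
  simp
  rfl

/-- The chart of `TQ` induced by the chart of `Q` around `q₀`. -/
abbrev tangentExtChart (q₀ : Q) : PartialEquiv (TangentBundle 𝓘(ℝ, E) Q) (E × E) :=
  extChartAt 𝓘(ℝ, E).tangent (⟨q₀, 0⟩ : TangentBundle 𝓘(ℝ, E) Q)

theorem mem_tangentExtChart_source {q₀ : Q} {V : TangentBundle 𝓘(ℝ, E) Q} :
    V ∈ (tangentExtChart q₀).source ↔ V.proj ∈ (extChartAt 𝓘(ℝ, E) q₀).source := by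
  rw [extChartAt_source, extChartAt_source]
  exact TangentBundle.mem_chart_source_iff _ _

theorem tangentExtChart_apply {q₀ : Q} {V : TangentBundle 𝓘(ℝ, E) Q}
    (hV : V ∈ (tangentExtChart q₀).source) : tangentExtChart q₀ V = tangentChart q₀ V :=
  (tangentChart_eq q₀ V (mem_tangentExtChart_source.1 hV)).symm

theorem fst_mem_target {q₀ : Q} {p : E × E} (hp : p ∈ (tangentExtChart q₀).target) :
    p.1 ∈ (extChartAt 𝓘(ℝ, E) q₀).target := by
  have h := (tangentExtChart q₀).map_target hp
  rw [← (tangentExtChart q₀).right_inv hp, tangentExtChart_apply h]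
  exact (extChartAt 𝓘(ℝ, E) q₀).map_source (mem_tangentExtChart_source.1 h)

theorem isOpen_tangentExtChart_target (q₀ : Q) :
    IsOpen (tangentExtChart q₀ : PartialEquiv (TangentBundle 𝓘(ℝ, E) Q) (E × E)).target :=
  isOpen_extChartAt_target _

/-- A map on `TQ` read in the chart of `TQ` induced by the chart of `Q` around `q₀`. -/
def localReading {F : Type*} (q₀ : Q) (H : TangentBundle 𝓘(ℝ, E) Q → F) (p : E × E) : F :=
  H ((tangentExtChart q₀).symm p)

theorem localReading_tangentExtChart {F : Type*} {q₀ : Q} {V : TangentBundle 𝓘(ℝ, E) Q}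
    (hV : V ∈ (tangentExtChart q₀).source) (H : TangentBundle 𝓘(ℝ, E) Q → F) :
    localReading q₀ H (tangentExtChart q₀ V) = H V :=
  congrArg H ((tangentExtChart q₀).left_inv hV)

theorem contMDiffAt_tangentExtChart_symm {q₀ : Q} {p : E × E}
    (hp : p ∈ (tangentExtChart q₀).target) :
    ContMDiffAt 𝓘(ℝ, E × E) 𝓘(ℝ, E).tangent ∞ (tangentExtChart q₀).symm p :=
  (contMDiffOn_extChartAt_symm _).contMDiffAt ((isOpen_tangentExtChart_target q₀).mem_nhds hp)

theorem contDiffAt_localReading {F : Type*} [NormedAddCommGroup F] [NormedSpace ℝ F] {q₀ : Q}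
    {n : ℕ∞} {H : TangentBundle 𝓘(ℝ, E) Q → F} {p : E × E} (hp : p ∈ (tangentExtChart q₀).target)
    (hH : ContMDiffAt 𝓘(ℝ, E).tangent 𝓘(ℝ, F) n H ((tangentExtChart q₀).symm p)) :
    ContDiffAt ℝ n (localReading q₀ H) p :=
  (hH.comp p ((contMDiffAt_tangentExtChart_symm hp).of_le (mod_cast le_top))).contDiffAt

theorem contMDiffAt_of_localReading {F : Type*} [NormedAddCommGroup F] [NormedSpace ℝ F] {q₀ : Q}
    {n : ℕ∞} {H : TangentBundle 𝓘(ℝ, E) Q → F} {V : TangentBundle 𝓘(ℝ, E) Q}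
    (hV : V ∈ (tangentExtChart q₀).source)
    (hH : ContDiffAt ℝ n (localReading q₀ H) (tangentExtChart q₀ V)) :
    ContMDiffAt 𝓘(ℝ, E).tangent 𝓘(ℝ, F) n H V := by
  have h := hH.contMDiffAt.comp V
    (contMDiffAt_extChartAt' (n := n) (I := 𝓘(ℝ, E).tangent) (by simpa using hV))
  refine h.congr_of_eventuallyEq ?_
  filter_upwards [(isOpen_extChartAt_source _).mem_nhds hV] with W hW
  exact (localReading_tangentExtChart hW H).symm

theorem mfderiv_eq_fderiv_localReading {q₀ : Q} {H : TangentBundle 𝓘(ℝ, E) Q → ℝ}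
    {V : TangentBundle 𝓘(ℝ, E) Q} (hV : V ∈ (tangentExtChart q₀).source)
    (hH : MDifferentiableAt 𝓘(ℝ, E).tangent 𝓘(ℝ, ℝ) H V) (Z : TangentSpace 𝓘(ℝ, E).tangent V) :
    mfderiv 𝓘(ℝ, E).tangent 𝓘(ℝ, ℝ) H V Z =
      fderiv ℝ (localReading q₀ H) (tangentExtChart q₀ V) (tangentChartDeriv q₀ V Z) := by
  have hs := (isOpen_extChartAt_source (I := 𝓘(ℝ, E).tangent)
    (⟨q₀, 0⟩ : TangentBundle 𝓘(ℝ, E) Q)).mem_nhds hV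
  have he : (tangentExtChart q₀ : TangentBundle 𝓘(ℝ, E) Q → E × E) =ᶠ[𝓝 V] tangentChart q₀ := by
    filter_upwards [hs] with W hW
    exact tangentExtChart_apply hW
  have hc : MDifferentiableAt 𝓘(ℝ, E).tangent 𝓘(ℝ, E × E) (tangentExtChart q₀) V :=
    mdifferentiableAt_extChartAt (by simpa using hV)
  have hr : MDifferentiableAt 𝓘(ℝ, E × E) 𝓘(ℝ, ℝ) (localReading q₀ H) (tangentExtChart q₀ V) := by
    refine MDifferentiableAt.comp _ ?_ ((contMDiffAt_tangentExtChart_symm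
      ((tangentExtChart q₀).map_source hV)).mdifferentiableAt (by simp))
    rwa [(tangentExtChart q₀).left_inv hV]
  have hH' : H =ᶠ[𝓝 V] localReading q₀ H ∘ tangentExtChart q₀ := by
    filter_upwards [hs] with W hW
    exact (localReading_tangentExtChart hW H).symm
  rw [hH'.mfderiv_eq, mfderiv_comp V hr hc, mfderiv_eq_fderiv, he.mfderiv_eq]
  rfl

end LocalReading

end WeakRiem

end

noncomputable section

namespace WeakRiem

/-! ### Covariant partial derivatives and Hamiltonian fields. -/

section HamiltonianFields

variable {E : Type*} [NormedAddCommGroup E] [NormedSpace ℝ E]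
  {Q : Type*} [TopologicalSpace Q] [ChartedSpace E Q] [IsManifold 𝓘(ℝ, E) ∞ Q]
  {m : WeakRiemannianMetric E Q} (C : RiemannianConnection m)

/-- The principal part, in the chart of `TQ` around `(q₀, 0)`, of a field of vectors along `τ`. -/
def principalPart (q₀ : Q) (X : ∀ V : TangentBundle 𝓘(ℝ, E) Q, TangentSpace 𝓘(ℝ, E) V.proj) :
    TangentBundle 𝓘(ℝ, E) Q → E :=
  fun V ↦ chartDeriv q₀ V.proj (X V)

/-- The base component is the projection `τ`, which is smooth, so only the fibre coordinate carries
a condition. -/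
theorem contMDiffAt_iff_principalPart {q₀ : Q} {k : ℕ∞} {V : TangentBundle 𝓘(ℝ, E) Q}
    (hV : V ∈ (tangentExtChart q₀).source)
    {X : ∀ V : TangentBundle 𝓘(ℝ, E) Q, TangentSpace 𝓘(ℝ, E) V.proj} :
    ContMDiffAt 𝓘(ℝ, E).tangent 𝓘(ℝ, E).tangent k
      (fun V ↦ (⟨V.proj, X V⟩ : TangentBundle 𝓘(ℝ, E) Q)) V ↔
    ContMDiffAt 𝓘(ℝ, E).tangent 𝓘(ℝ, E) k (principalPart q₀ X) V := by
  have hs : ∀ W : TangentBundle 𝓘(ℝ, E) Q, W ∈ (tangentExtChart q₀).source →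
      W.proj ∈ (trivializationAt E (TangentSpace 𝓘(ℝ, E)) q₀).baseSet := fun W hW ↦ by
    simpa using mem_tangentExtChart_source.1 hW
  rw [(trivializationAt E (TangentSpace 𝓘(ℝ, E)) q₀).contMDiffAt_iff
    (by rw [Trivialization.mem_source]; exact hs V hV)]
  have he : (fun W : TangentBundle 𝓘(ℝ, E) Q ↦
      (trivializationAt E (TangentSpace 𝓘(ℝ, E)) q₀ ⟨W.proj, X W⟩).2) =ᶠ[𝓝 V]
      principalPart q₀ X := by
    filter_upwards [(isOpen_extChartAt_source _).mem_nhds hV] with W hW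
    exact (chartDeriv_eq_trivializationAt (mem_tangentExtChart_source.1 hW) _).symm
  rw [he.contMDiffAt_iff]
  exact and_iff_right (contMDiff_proj (TangentSpace 𝓘(ℝ, E))).contMDiffAt

/-- `Θ` is a fibrewise isomorphism, so `Z` is the sum of its horizontal and vertical parts. -/
theorem mfderiv_eq_covPartial (H : TangentBundle 𝓘(ℝ, E) Q → ℝ) (V : TangentBundle 𝓘(ℝ, E) Q)
    (Z : TangentSpace 𝓘(ℝ, E).tangent V) :
    mfderiv 𝓘(ℝ, E).tangent 𝓘(ℝ, ℝ) H V Z =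
      covPartialBase C H V (Theta C V Z).1 + covPartialFibre C H V (Theta C V Z).2 := by
  have hinv : (Theta C V).inverse (Theta C V Z) = Z := by
    obtain ⟨A, hA⟩ := isInvertible_Theta C V
    rw [← hA, ContinuousLinearMap.inverse_equiv]
    exact A.symm_apply_apply Z
  have h : ∀ a b : TangentSpace 𝓘(ℝ, E) V.proj,
      (Theta C V).inverse (a, b) = (Theta C V).inverse (a, 0) + (Theta C V).inverse (0, b) := by
    intro a b
    rw [← map_add]
    simp
  conv_lhs => rw [← hinv, ← Prod.mk.eta (p := Theta C V Z), h, map_add]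
  rfl

theorem Theta_inverse (V : TangentBundle 𝓘(ℝ, E) Q)
    (W : TangentSpace 𝓘(ℝ, E) V.proj) : Theta C V ((Theta C V).inverse (W, 0)) = (W, 0) ∧
      Theta C V ((Theta C V).inverse (0, W)) = (0, W) := by
  obtain ⟨A, hA⟩ := isInvertible_Theta C V
  rw [← hA, ContinuousLinearMap.inverse_equiv]
  exact ⟨A.apply_symm_apply _, A.apply_symm_apply _⟩

variable {C}

theorem chartDeriv_Theta_fst {q₀ : Q} {V : TangentBundle 𝓘(ℝ, E) Q}
    (hV : V ∈ (tangentExtChart q₀).source) (Z : TangentSpace 𝓘(ℝ, E).tangent V) :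
    chartDeriv q₀ V.proj (Theta C V Z).1 = (tangentChartDeriv q₀ V Z).1 :=
  chartDeriv_mfderiv_proj q₀ V (mem_tangentExtChart_source.1 hV) Z

theorem chartDeriv_Theta_snd {q₀ : Q} {V : TangentBundle 𝓘(ℝ, E) Q}
    (hV : V ∈ (tangentExtChart q₀).source) (Z : TangentSpace 𝓘(ℝ, E).tangent V) :
    chartDeriv q₀ V.proj (Theta C V Z).2 = (tangentChartDeriv q₀ V Z).2 +
      C.christoffel q₀ (tangentExtChart q₀ V).1 (tangentExtChart q₀ V).2
        (tangentChartDeriv q₀ V Z).1 := by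
  rw [tangentExtChart_apply hV]
  exact C.connector_eq q₀ V (mem_tangentExtChart_source.1 hV) Z

variable (C) in
/-- The field `(y, -x)`, with horizontal part `y` and vertical part `-x`, of tangent vectors of
`TQ` in the chart of `TQ` around `(q₀, 0)`. -/
def hamiltonianField (q₀ : Q) (x y : E × E → E) (p : E × E) : E × E :=
  (y p, -x p - C.christoffel q₀ p.1 p.2 (y p))

theorem contDiffAt_hamiltonianField {q₀ : Q} {n : ℕ∞} {x y : E × E → E} {p : E × E}
    (hp : p ∈ (tangentExtChart q₀).target) (hx : ContDiffAt ℝ n x p) (hy : ContDiffAt ℝ n y p) :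
    ContDiffAt ℝ n (hamiltonianField C q₀ x y) p := by
  have h1 : ContDiffAt ℝ n (C.christoffel q₀) p.1 := ((C.contDiffOn q₀).contDiffAt
    ((isOpen_extChartAt_target q₀).mem_nhds (fst_mem_target hp))).of_le (mod_cast le_top)
  have h2 : ContDiffAt ℝ n (fun p : E × E ↦ C.christoffel q₀ p.1 p.2) p :=
    (h1.comp p contDiffAt_fst).clm_apply contDiffAt_snd
  exact hy.prodMk (hx.neg.sub (h2.clm_apply hy))

/-- The symplectic form of `TQ` in the chart of `TQ` around `(q₀, 0)`. -/
def localForm (m : WeakRiemannianMetric E Q) (q₀ : Q) : E × E → E × E →L[ℝ] E × E →L[ℝ] ℝ :=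
  extDerivOne (canonicalForm (localMetric m q₀))

theorem localMetric_symm {q₀ : Q} (x a b : E) :
    localMetric m q₀ x a b = localMetric m q₀ x b a :=
  m.symm _ _ _

theorem localForm_apply {q₀ : Q} {p : E × E} (hp : p ∈ (tangentExtChart q₀).target)
    (a b : E × E) : localForm m q₀ p a b =
      localMetric m q₀ p.1 (a.2 + C.christoffel q₀ p.1 p.2 a.1) b.1 -
        localMetric m q₀ p.1 a.1 (b.2 + C.christoffel q₀ p.1 p.2 b.1) :=
  extDerivOne_canonicalForm
    ((contDiffAt_localMetric m (fst_mem_target hp)).differentiableAt (by simp))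
    (localMetric_symm _) (C.symm q₀ _ (fst_mem_target hp)) (C.metric q₀ _ (fst_mem_target hp)) a b

/-- The Christoffel term in `hamiltonianField` is chosen so that the connector returns exactly `-x`.
-/
theorem localForm_hamiltonianField {q₀ : Q} {x y : E × E → E} {p : E × E}
    (hp : p ∈ (tangentExtChart q₀).target) (b : E × E) :
    localForm m q₀ p (hamiltonianField C q₀ x y p) b = -(localMetric m q₀ p.1 (x p) b.1 +
        localMetric m q₀ p.1 (y p) (b.2 + C.christoffel q₀ p.1 p.2 b.1)) := by
  rw [localForm_apply (C := C) hp]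
  simp [hamiltonianField]
  ring

/-- In the chart, the differential of `H` is represented by the vector field whose components
represent the covariant partial derivatives of `H`, and conversely. -/
theorem represents_iff {q₀ : Q} {H : TangentBundle 𝓘(ℝ, E) Q → ℝ} {V : TangentBundle 𝓘(ℝ, E) Q}
    (hV : V ∈ (tangentExtChart q₀).source)
    (hH : MDifferentiableAt 𝓘(ℝ, E).tangent 𝓘(ℝ, ℝ) H V) {x y : E × E → E}
    {X Y : TangentSpace 𝓘(ℝ, E) V.proj}
    (hX : chartDeriv q₀ V.proj X = x (tangentExtChart q₀ V))
    (hY : chartDeriv q₀ V.proj Y = y (tangentExtChart q₀ V)) :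
    (covPartialBase C H V = m.inner V.proj X ∧ covPartialFibre C H V = m.inner V.proj Y) ↔
    fderiv ℝ (localReading q₀ H) (tangentExtChart q₀ V) =
      -localForm m q₀ (tangentExtChart q₀ V)
        (hamiltonianField C q₀ x y (tangentExtChart q₀ V)) := by
  have hq := mem_tangentExtChart_source.1 hV
  have hfst : (tangentExtChart q₀ V).1 = extChartAt 𝓘(ℝ, E) q₀ V.proj := by
    rw [tangentExtChart_apply hV]; rfl
  -- The contracted form pairs `X` with the horizontal and `Y` with the vertical part of `Z`, the
  -- shape of `mfderiv_eq_covPartial`.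
  have key : ∀ Z : TangentSpace 𝓘(ℝ, E).tangent V,
      -localForm m q₀ (tangentExtChart q₀ V) (hamiltonianField C q₀ x y (tangentExtChart q₀ V))
        (tangentChartDeriv q₀ V Z) =
      m.inner V.proj X (Theta C V Z).1 + m.inner V.proj Y (Theta C V Z).2 := fun Z ↦ by
    rw [localForm_hamiltonianField ((tangentExtChart q₀).map_source hV), neg_neg,
      ← chartDeriv_Theta_snd hV, ← chartDeriv_Theta_fst (C := C) hV, ← hX, ← hY, hfst,
      localMetric_chartDeriv m hq, localMetric_chartDeriv m hq]
  constructor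
  · rintro ⟨h1, h2⟩
    refine ContinuousLinearMap.ext fun c ↦ ?_
    obtain ⟨B, hB⟩ := isInvertible_tangentChartDeriv q₀ V hq
    obtain ⟨Z, rfl⟩ : ∃ Z, tangentChartDeriv q₀ V Z = c :=
      ⟨B.symm c, by rw [← hB]; exact B.apply_symm_apply c⟩
    rw [neg_apply, key, ← h1, ← h2, ← mfderiv_eq_covPartial]
    exact (mfderiv_eq_fderiv_localReading hV hH Z).symm
  · intro h
    have h' : ∀ Z, mfderiv 𝓘(ℝ, E).tangent 𝓘(ℝ, ℝ) H V Z =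
        m.inner V.proj X (Theta C V Z).1 + m.inner V.proj Y (Theta C V Z).2 := fun Z ↦ by
      rw [← key, mfderiv_eq_fderiv_localReading hV hH, h, neg_apply]
    -- Purely horizontal and purely vertical test vectors separate the two covectors.
    constructor
    · ext W
      refine (h' ((Theta C V).inverse (W, 0))).trans ?_
      rw [(Theta_inverse C V W).1]
      simp
      rfl
    · ext W
      refine (h' ((Theta C V).inverse (0, W))).trans ?_
      rw [(Theta_inverse C V W).2]
      simp
      rfl

end HamiltonianFields

end WeakRiem

end

noncomputable section

namespace WeakRiem

/-! ### Representing vectors, and the algebraic identities on each `𝒦^k(TQ)`. -/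

section Bracket

variable {E : Type*} [NormedAddCommGroup E] [NormedSpace ℝ E]
  {Q : Type*} [TopologicalSpace Q] [ChartedSpace E Q] [IsManifold 𝓘(ℝ, E) ∞ Q]
  {m : WeakRiemannianMetric E Q} {C : RiemannianConnection m}

/-- Positivity on `a - b` makes representing vectors unique; their existence is supplied by
membership in `classK`. -/
theorem WeakRiemannianMetric.inner_injective (m : WeakRiemannianMetric E Q) (q : Q) :
    Function.Injective (m.inner q) := fun a b h ↦ by
  by_contra hab
  have h1 := m.pos q (a - b) (sub_ne_zero.2 hab)
  have h2 : m.inner q (a - b) = 0 := by rw [map_sub, h, sub_self]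
  rw [h2] at h1
  exact lt_irrefl _ h1

theorem WeakRiemannianMetric.inner_sharp (m : WeakRiemannianMetric E Q) {q : Q}
    {A : TangentSpace 𝓘(ℝ, E) q →L[ℝ] ℝ} (hA : ∃ Z, m.inner q Z = A) :
    m.inner q (m.sharp q A) = A := by
  rw [WeakRiemannianMetric.sharp, dif_pos hA]
  exact hA.choose_spec

theorem WeakRiemannianMetric.sharp_eq (m : WeakRiemannianMetric E Q) {q : Q}
    {A : TangentSpace 𝓘(ℝ, E) q →L[ℝ] ℝ} {Z : TangentSpace 𝓘(ℝ, E) q} (hA : A = m.inner q Z) :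
    m.sharp q A = Z :=
  m.inner_injective q ((m.inner_sharp ⟨Z, hA.symm⟩).trans hA)

/-- By uniqueness the witness `Z` must be the field given by `sharp`. -/
theorem isContMDiffField_iff {k : ℕ∞}
    {A : ∀ V : TangentBundle 𝓘(ℝ, E) Q, TangentSpace 𝓘(ℝ, E) V.proj →L[ℝ] ℝ} :
    IsContMDiffField m k A ↔ ContMDiff 𝓘(ℝ, E).tangent 𝓘(ℝ, E).tangent k
      (fun V ↦ (⟨V.proj, m.sharp V.proj (A V)⟩ : TangentBundle 𝓘(ℝ, E) Q)) ∧
        ∀ V, m.inner V.proj (m.sharp V.proj (A V)) = A V := by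
  constructor
  · rintro ⟨Z, hZ, hA⟩
    have hA' : ∀ V, A V = m.inner V.proj (Z V) := fun V ↦ ContinuousLinearMap.ext (hA V)
    simp only [m.sharp_eq (hA' _)]
    exact ⟨hZ, fun V ↦ (hA' V).symm⟩
  · exact fun h ↦ ⟨_, h.1, fun V W ↦ by rw [h.2]⟩

variable (C) in
/-- The covariant partial derivative `∂f/∂η` as a field of vectors along `τ`. -/
def gradBase (f : TangentBundle 𝓘(ℝ, E) Q → ℝ) (V : TangentBundle 𝓘(ℝ, E) Q) :
    TangentSpace 𝓘(ℝ, E) V.proj :=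
  m.sharp V.proj (covPartialBase C f V)

variable (C) in
/-- The covariant partial derivative `∂f/∂v` as a field of vectors along `τ`. -/
def gradFibre (f : TangentBundle 𝓘(ℝ, E) Q → ℝ) (V : TangentBundle 𝓘(ℝ, E) Q) :
    TangentSpace 𝓘(ℝ, E) V.proj :=
  m.sharp V.proj (covPartialFibre C f V)

variable {k : ℕ∞} {f f₁ f₂ g h : TangentBundle 𝓘(ℝ, E) Q → ℝ}

theorem mdifferentiable_of_mem_classK (hf : f ∈ classK C k) :
    MDifferentiable 𝓘(ℝ, E).tangent 𝓘(ℝ, ℝ) f :=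
  hf.1.mdifferentiable (by simp)

theorem inner_gradBase (hf : f ∈ classK C k) (V : TangentBundle 𝓘(ℝ, E) Q) :
    m.inner V.proj (gradBase C f V) = covPartialBase C f V :=
  (isContMDiffField_iff.1 hf.2.1).2 V

theorem inner_gradFibre (hf : f ∈ classK C k) (V : TangentBundle 𝓘(ℝ, E) Q) :
    m.inner V.proj (gradFibre C f V) = covPartialFibre C f V :=
  (isContMDiffField_iff.1 hf.2.2).2 V

/-- This form is linear in the differential of `f`, with the vectors attached to `g` held fixed, so
identities in the left factor need nothing of `g`. -/
theorem poissonBracket_apply (hf : f ∈ classK C k) (V : TangentBundle 𝓘(ℝ, E) Q) :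
    poissonBracket C f g V =
      covPartialBase C f V (gradFibre C g V) - covPartialFibre C f V (gradBase C g V) := by
  rw [← inner_gradBase hf, ← inner_gradFibre hf]
  rfl

variable (C) in
theorem poissonBracket_antisymm (f g : TangentBundle 𝓘(ℝ, E) Q → ℝ) :
    poissonBracket C f g = -poissonBracket C g f := by
  ext V
  simp only [poissonBracket, Pi.neg_apply]
  rw [m.symm _ _ (m.sharp V.proj (covPartialFibre C g V)),
    m.symm _ _ (m.sharp V.proj (covPartialBase C g V))]
  ring

/-- The differential of a function on `TQ`, as a covector. -/
def differential (H : TangentBundle 𝓘(ℝ, E) Q → ℝ) (V : TangentBundle 𝓘(ℝ, E) Q) :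
    TangentSpace 𝓘(ℝ, E).tangent V →L[ℝ] ℝ :=
  mfderiv 𝓘(ℝ, E).tangent 𝓘(ℝ, ℝ) H V

theorem differential_linearCombination (hf₁ : f₁ ∈ classK C k) (hf₂ : f₂ ∈ classK C k) (a b : ℝ)
    (V : TangentBundle 𝓘(ℝ, E) Q) (Z : TangentSpace 𝓘(ℝ, E).tangent V) :
    differential (a • f₁ + b • f₂) V Z =
      a * differential f₁ V Z + b * differential f₂ V Z := by
  have h1 := mdifferentiable_of_mem_classK hf₁ V
  have h2 := mdifferentiable_of_mem_classK hf₂ V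
  rw [differential, ((h1.hasMFDerivAt.const_smul a).add (h2.hasMFDerivAt.const_smul b)).mfderiv]
  rfl

theorem poissonBracket_linearCombination_left (hf₁ : f₁ ∈ classK C k) (hf₂ : f₂ ∈ classK C k)
    (a b : ℝ) : poissonBracket C (a • f₁ + b • f₂) g =
      a • poissonBracket C f₁ g + b • poissonBracket C f₂ g := by
  ext V
  have hf := add_mem ((classK C k).smul_mem hf₁ a) ((classK C k).smul_mem hf₂ b)
  simp only [Pi.add_apply, Pi.smul_apply, smul_eq_mul]
  rw [poissonBracket_apply hf, poissonBracket_apply hf₁, poissonBracket_apply hf₂]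
  have hd := differential_linearCombination hf₁ hf₂ a b V
  -- A covariant partial derivative is by definition the differential at `Θ⁻¹(W, 0)` or `Θ⁻¹(0, W)`.
  have h1 : ∀ W, covPartialBase C (a • f₁ + b • f₂) V W =
      a * covPartialBase C f₁ V W + b * covPartialBase C f₂ V W := fun W ↦ hd _
  have h2 : ∀ W, covPartialFibre C (a • f₁ + b • f₂) V W =
      a * covPartialFibre C f₁ V W + b * covPartialFibre C f₂ V W := fun W ↦ hd _
  rw [h1, h2]
  ring

theorem poissonBracket_linearCombination_right (hf₁ : f₁ ∈ classK C k) (hf₂ : f₂ ∈ classK C k)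
    (a b : ℝ) : poissonBracket C g (a • f₁ + b • f₂) =
      a • poissonBracket C g f₁ + b • poissonBracket C g f₂ := by
  rw [poissonBracket_antisymm, poissonBracket_linearCombination_left hf₁ hf₂,
    poissonBracket_antisymm C g f₁, poissonBracket_antisymm C g f₂]
  simp only [smul_neg, neg_add]

theorem differential_mul (hf₁ : f₁ ∈ classK C k) (hf₂ : f₂ ∈ classK C k)
    (V : TangentBundle 𝓘(ℝ, E) Q) (Z : TangentSpace 𝓘(ℝ, E).tangent V) :
    differential (f₁ * f₂) V Z =
      f₁ V * differential f₂ V Z + f₂ V * differential f₁ V Z := by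
  have h1 := mdifferentiable_of_mem_classK hf₁ V
  have h2 := mdifferentiable_of_mem_classK hf₂ V
  rw [differential, (h1.hasMFDerivAt.mul h2.hasMFDerivAt).mfderiv]
  rfl

theorem poissonBracket_mul_left (hf₁ : f₁ ∈ classK C k) (hf₂ : f₂ ∈ classK C k) :
    poissonBracket C (f₁ * f₂) g = f₁ * poissonBracket C f₂ g + f₂ * poissonBracket C f₁ g := by
  ext V
  simp only [Pi.add_apply, Pi.mul_apply]
  rw [poissonBracket_apply (mul_mem hf₁ hf₂), poissonBracket_apply hf₁, poissonBracket_apply hf₂]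
  have hd := differential_mul hf₁ hf₂ V
  have h1 : ∀ W, covPartialBase C (f₁ * f₂) V W =
      f₁ V * covPartialBase C f₂ V W + f₂ V * covPartialBase C f₁ V W := fun W ↦ hd _
  have h2 : ∀ W, covPartialFibre C (f₁ * f₂) V W =
      f₁ V * covPartialFibre C f₂ V W + f₂ V * covPartialFibre C f₁ V W := fun W ↦ hd _
  rw [h1, h2]
  ring

theorem poissonBracket_mul_right (hf₁ : f₁ ∈ classK C k) (hf₂ : f₂ ∈ classK C k) :
    poissonBracket C g (f₁ * f₂) = f₁ * poissonBracket C g f₂ + f₂ * poissonBracket C g f₁ := by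
  rw [poissonBracket_antisymm, poissonBracket_mul_left hf₁ hf₂,
    poissonBracket_antisymm C g f₁, poissonBracket_antisymm C g f₂]
  ring

/-! ### The bracket in a chart, closure of `𝒦(TQ)` and the Jacobi identity. -/

variable (C) in
/-- The Hamiltonian vector field of `f` in the chart of `TQ` around `(q₀, 0)`. -/
def localHamiltonian (q₀ : Q) (f : TangentBundle 𝓘(ℝ, E) Q → ℝ) : E × E → E × E :=
  hamiltonianField C q₀ (localReading q₀ (principalPart q₀ (gradBase C f)))
    (localReading q₀ (principalPart q₀ (gradFibre C f)))

variable {q₀ : Q} {p : E × E}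

theorem contDiffAt_localReading_of_mem_classK (hp : p ∈ (tangentExtChart q₀).target)
    (hf : f ∈ classK C ⊤) : ContDiffAt ℝ ∞ (localReading q₀ f) p :=
  contDiffAt_localReading (n := ⊤) hp (hf.1 _)

theorem contDiffAt_localHamiltonian (hp : p ∈ (tangentExtChart q₀).target)
    (hf : f ∈ classK C ⊤) : ContDiffAt ℝ ∞ (localHamiltonian C q₀ f) p := by
  have hV := (tangentExtChart q₀).map_target hp
  exact contDiffAt_hamiltonianField (n := ⊤) hp
    (contDiffAt_localReading hp ((contMDiffAt_iff_principalPart hV).1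
      ((isContMDiffField_iff.1 hf.2.1).1 _)))
    (contDiffAt_localReading hp ((contMDiffAt_iff_principalPart hV).1
      ((isContMDiffField_iff.1 hf.2.2).1 _)))

theorem fderiv_localReading (hp : p ∈ (tangentExtChart q₀).target) (hf : f ∈ classK C k) :
    fderiv ℝ (localReading q₀ f) p = -localForm m q₀ p (localHamiltonian C q₀ f p) := by
  have hV := (tangentExtChart q₀).map_target hp
  have h := (represents_iff (C := C) (q₀ := q₀) (X := gradBase C f _) (Y := gradFibre C f _)
    (x := localReading q₀ (principalPart q₀ (gradBase C f)))
    (y := localReading q₀ (principalPart q₀ (gradFibre C f))) hV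
    (mdifferentiable_of_mem_classK hf _)
    (localReading_tangentExtChart hV (principalPart q₀ (gradBase C f))).symm
    (localReading_tangentExtChart hV (principalPart q₀ (gradFibre C f))).symm).1
    ⟨(inner_gradBase hf _).symm, (inner_gradFibre hf _).symm⟩
  rwa [(tangentExtChart q₀).right_inv hp] at h

theorem isHamiltonianAt_localReading (hp : p ∈ (tangentExtChart q₀).target)
    (hf : f ∈ classK C k) :
    IsHamiltonianAt (localForm m q₀) (localReading q₀ f) (localHamiltonian C q₀ f) p := by
  filter_upwards [(isOpen_tangentExtChart_target q₀).mem_nhds hp] with q hq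
  exact fderiv_localReading hq hf

/-- This is `{f, g} = df(X_g)`: the Christoffel terms cancel, leaving `∂g/∂v` and `-∂g/∂η` as the
horizontal and vertical parts of `X_g`. -/
theorem localReading_poissonBracket (hp : p ∈ (tangentExtChart q₀).target) (hf : f ∈ classK C k) :
    localReading q₀ (poissonBracket C f g) p =
      fderiv ℝ (localReading q₀ f) p (localHamiltonian C q₀ g p) := by
  have hV := (tangentExtChart q₀).map_target hp
  have hq := mem_tangentExtChart_source.1 hV
  have hfst : p.1 = extChartAt 𝓘(ℝ, E) q₀ ((tangentExtChart q₀).symm p).proj := by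
    conv_lhs => rw [← (tangentExtChart q₀).right_inv hp, tangentExtChart_apply hV]
    rfl
  rw [fderiv_localReading hp hf, neg_apply, localHamiltonian, localForm_hamiltonianField hp,
    neg_neg, hfst]
  simp only [localHamiltonian, hamiltonianField, localReading, principalPart, sub_add_cancel, hfst,
    map_neg]
  rw [localMetric_chartDeriv m hq, localMetric_chartDeriv m hq]
  rfl

theorem contDiffAt_localForm (hp : p ∈ (tangentExtChart q₀).target) :
    ContDiffAt ℝ ∞ (localForm m q₀) p :=
  contDiffAt_extDerivOne (contDiffAt_canonicalForm (contDiffAt_localMetric m (fst_mem_target hp)))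

theorem localForm_closed (hp : p ∈ (tangentExtChart q₀).target) (a b c : E × E) :
    fderiv ℝ (localForm m q₀) p a b c + fderiv ℝ (localForm m q₀) p b c a +
      fderiv ℝ (localForm m q₀) p c a b = 0 :=
  extDerivOne_closed (contDiffAt_canonicalForm (contDiffAt_localMetric m (fst_mem_target hp))) a b c

theorem localReading_poissonBracket_eventuallyEq (hp : p ∈ (tangentExtChart q₀).target)
    (hf : f ∈ classK C k) : localReading q₀ (poissonBracket C f g) =ᶠ[𝓝 p]
      fun q ↦ fderiv ℝ (localReading q₀ f) q (localHamiltonian C q₀ g q) := by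
  filter_upwards [(isOpen_tangentExtChart_target q₀).mem_nhds hp] with q hq
  exact localReading_poissonBracket hq hf

/-- The Lie bracket of the Hamiltonian vector fields of `f` and `g` in the chart. -/
theorem fderiv_localReading_poissonBracket (hp : p ∈ (tangentExtChart q₀).target)
    (hf : f ∈ classK C ⊤) (hg : g ∈ classK C ⊤) :
    fderiv ℝ (localReading q₀ (poissonBracket C f g)) p =
      -localForm m q₀ p (fderiv ℝ (localHamiltonian C q₀ f) p (localHamiltonian C q₀ g p) -
        fderiv ℝ (localHamiltonian C q₀ g) p (localHamiltonian C q₀ f p)) := by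
  rw [(localReading_poissonBracket_eventuallyEq hp hf).fderiv_eq]
  exact (isHamiltonianAt_localReading hp hf).fderiv_bracket (isHamiltonianAt_localReading hp hg)
    ((contDiffAt_localForm hp).differentiableAt (by simp))
    ((contDiffAt_localHamiltonian hp hf).differentiableAt (by simp))
    ((contDiffAt_localHamiltonian hp hg).differentiableAt (by simp))
    ((contDiffAt_localReading_of_mem_classK hp hf).of_le (by simpa using ENat.LEInfty.out))
    ((contDiffAt_localReading_of_mem_classK hp hg).of_le (by simpa using ENat.LEInfty.out))
    (Filter.Eventually.of_forall fun q ↦ extDerivOne_antisymm _ q) (localForm_closed hp)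

theorem contMDiff_poissonBracket (hf : f ∈ classK C ⊤) (hg : g ∈ classK C ⊤) :
    ContMDiff 𝓘(ℝ, E).tangent 𝓘(ℝ, ℝ) ∞ (poissonBracket C f g) := by
  intro V
  have hV : V ∈ (tangentExtChart V.proj).source :=
    mem_tangentExtChart_source.2 (mem_extChartAt_source _)
  have hp := (tangentExtChart V.proj).map_source hV
  refine contMDiffAt_of_localReading (n := ⊤) hV ?_
  refine ContDiffAt.congr_of_eventuallyEq ?_ (localReading_poissonBracket_eventuallyEq hp hf)
  exact ((contDiffAt_localReading_of_mem_classK hp hf).fderiv_right (m := ∞) (by simp)).clm_apply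
    (contDiffAt_localHamiltonian hp hg)

/-- A smooth function whose differential is represented by a smooth vector field in every chart
belongs to `𝒦(TQ)`. -/
theorem mem_classK_top_of_represented (hf : ContMDiff 𝓘(ℝ, E).tangent 𝓘(ℝ, ℝ) ∞ f)
    (Z : Q → E × E → E × E)
    (hZ : ∀ q₀, ∀ p ∈ (tangentExtChart q₀).target, ContDiffAt ℝ ∞ (Z q₀) p)
    (hfZ : ∀ q₀, ∀ p ∈ (tangentExtChart q₀).target,
      fderiv ℝ (localReading q₀ f) p = -localForm m q₀ p (Z q₀ p)) :
    f ∈ classK C ⊤ := by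
  let y : Q → E × E → E := fun q₀ p ↦ (Z q₀ p).1
  -- Chosen to solve `-x - Γ(v, y) = Z.2`, so that `hamiltonianField` gives back `Z`.
  let x : Q → E × E → E := fun q₀ p ↦ -((Z q₀ p).2 + C.christoffel q₀ p.1 p.2 (Z q₀ p).1)
  have hxy : ∀ q₀ p, hamiltonianField C q₀ (x q₀) (y q₀) p = Z q₀ p := fun q₀ p ↦
    Prod.ext rfl (by simp [hamiltonianField, x, y])
  have hy : ∀ q₀, ∀ p ∈ (tangentExtChart q₀).target, ContDiffAt ℝ ∞ (y q₀) p := fun q₀ p hp ↦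
    contDiffAt_fst.comp p (hZ q₀ p hp)
  have hx : ∀ q₀, ∀ p ∈ (tangentExtChart q₀).target, ContDiffAt ℝ ∞ (x q₀) p := fun q₀ p hp ↦ by
    have h1 : ContDiffAt ℝ ∞ (C.christoffel q₀) p.1 := (C.contDiffOn q₀).contDiffAt
      ((isOpen_extChartAt_target q₀).mem_nhds (fst_mem_target hp))
    have h2 : ContDiffAt ℝ ∞ (fun p : E × E ↦ C.christoffel q₀ p.1 p.2) p :=
      (h1.comp p contDiffAt_fst).clm_apply contDiffAt_snd
    exact ((contDiffAt_snd.comp p (hZ q₀ p hp)).add (h2.clm_apply (hy q₀ p hp))).neg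
  have key : ∀ q₀ V, V ∈ (tangentExtChart q₀).source → ∃ X Y : TangentSpace 𝓘(ℝ, E) V.proj,
      chartDeriv q₀ V.proj X = x q₀ (tangentExtChart q₀ V) ∧
      chartDeriv q₀ V.proj Y = y q₀ (tangentExtChart q₀ V) ∧
      covPartialBase C f V = m.inner V.proj X ∧ covPartialFibre C f V = m.inner V.proj Y := by
    intro q₀ V hV
    obtain ⟨X, hX⟩ := exists_chartDeriv_eq (mem_tangentExtChart_source.1 hV)
      (x q₀ (tangentExtChart q₀ V))
    obtain ⟨Y, hY⟩ := exists_chartDeriv_eq (mem_tangentExtChart_source.1 hV)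
      (y q₀ (tangentExtChart q₀ V))
    refine ⟨X, Y, hX, hY, (represents_iff hV (hf.mdifferentiable (by simp) V) hX hY).2 ?_⟩
    rw [hxy]
    exact hfZ q₀ _ ((tangentExtChart q₀).map_source hV)
  have smooth : ∀ (X : ∀ V : TangentBundle 𝓘(ℝ, E) Q, TangentSpace 𝓘(ℝ, E) V.proj)
      (z : Q → E × E → E), (∀ q₀, ∀ p ∈ (tangentExtChart q₀).target, ContDiffAt ℝ ∞ (z q₀) p) →
      (∀ q₀ V, V ∈ (tangentExtChart q₀).source →
        chartDeriv q₀ V.proj (X V) = z q₀ (tangentExtChart q₀ V)) →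
      ContMDiff 𝓘(ℝ, E).tangent 𝓘(ℝ, E).tangent ((⊤ : ℕ∞) : WithTop ℕ∞)
        (fun V ↦ (⟨V.proj, X V⟩ : TangentBundle 𝓘(ℝ, E) Q)) := by
    intro X z hz hXz V
    have hV : V ∈ (tangentExtChart V.proj).source :=
      mem_tangentExtChart_source.2 (mem_extChartAt_source _)
    have hp := (tangentExtChart V.proj).map_source hV
    refine (contMDiffAt_iff_principalPart hV).2 (contMDiffAt_of_localReading hV ?_)
    refine (hz V.proj _ hp).congr_of_eventuallyEq ?_
    filter_upwards [(isOpen_tangentExtChart_target V.proj).mem_nhds hp] with p hp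
    have h := hXz V.proj _ ((tangentExtChart V.proj).map_target hp)
    rwa [(tangentExtChart V.proj).right_inv hp] at h
  have hsource : ∀ V : TangentBundle 𝓘(ℝ, E) Q, V ∈ (tangentExtChart V.proj).source := fun V ↦
    mem_tangentExtChart_source.2 (mem_extChartAt_source _)
  -- The vectors found in different charts agree, both being the unique one given by `sharp`; hence
  -- the local fields glue without a compatibility assumption on `Z`.
  refine ⟨hf, isContMDiffField_iff.2 ⟨smooth _ x hx fun q₀ V hV ↦ ?_, fun V ↦ ?_⟩,
    isContMDiffField_iff.2 ⟨smooth _ y hy fun q₀ V hV ↦ ?_, fun V ↦ ?_⟩⟩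
  · obtain ⟨X, Y, hX, hY, h1, h2⟩ := key q₀ V hV
    rw [m.sharp_eq h1, hX]
  · obtain ⟨X, Y, hX, hY, h1, h2⟩ := key V.proj V (hsource V)
    exact m.inner_sharp ⟨X, h1.symm⟩
  · obtain ⟨X, Y, hX, hY, h1, h2⟩ := key q₀ V hV
    rw [m.sharp_eq h2, hY]
  · obtain ⟨X, Y, hX, hY, h1, h2⟩ := key V.proj V (hsource V)
    exact m.inner_sharp ⟨Y, h2.symm⟩

/-- The commutator of the two Hamiltonian fields represents the differential of the bracket. It
involves their first derivatives, so one order of smoothness is spent, which is harmless at `k = ∞`.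
-/
theorem poissonBracket_mem_classK (hf : f ∈ classK C ⊤) (hg : g ∈ classK C ⊤) :
    poissonBracket C f g ∈ classK C ⊤ := by
  refine mem_classK_top_of_represented (contMDiff_poissonBracket hf hg)
    (fun q₀ p ↦ fderiv ℝ (localHamiltonian C q₀ f) p (localHamiltonian C q₀ g p) -
        fderiv ℝ (localHamiltonian C q₀ g) p (localHamiltonian C q₀ f p))
    (fun q₀ p hp ↦ ?_) fun q₀ p hp ↦ fderiv_localReading_poissonBracket hp hf hg
  have h1 := contDiffAt_localHamiltonian hp hf
  have h2 := contDiffAt_localHamiltonian hp hg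
  exact ((h1.fderiv_right (m := ∞) (by simp)).clm_apply h2).sub
    ((h2.fderiv_right (m := ∞) (by simp)).clm_apply h1)

theorem poissonBracket_jacobi (hf : f ∈ classK C ⊤) (hg : g ∈ classK C ⊤) (hh : h ∈ classK C ⊤) :
    poissonBracket C (poissonBracket C f g) h + poissonBracket C (poissonBracket C g h) f +
      poissonBracket C (poissonBracket C h f) g = 0 := by
  ext V
  have hV : V ∈ (tangentExtChart V.proj).source :=
    mem_tangentExtChart_source.2 (mem_extChartAt_source _)
  have hp := (tangentExtChart V.proj).map_source hV
  -- Closure lets the outer bracket be read as the derivative of `df(X_g)` along `X_h`.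
  have key : ∀ {f g h : TangentBundle 𝓘(ℝ, E) Q → ℝ}, f ∈ classK C ⊤ → g ∈ classK C ⊤ →
      poissonBracket C (poissonBracket C f g) h V =
        fderiv ℝ (fun q ↦ fderiv ℝ (localReading V.proj f) q (localHamiltonian C V.proj g q))
          (tangentExtChart V.proj V) (localHamiltonian C V.proj h (tangentExtChart V.proj V)) := by
    intro f g h hf hg
    rw [← localReading_tangentExtChart hV (poissonBracket C (poissonBracket C f g) h),
      localReading_poissonBracket hp (poissonBracket_mem_classK hf hg),
      (localReading_poissonBracket_eventuallyEq hp hf).fderiv_eq]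
  simp only [Pi.add_apply, Pi.zero_apply]
  rw [key hf hg, key hg hh, key hh hf]
  have hX : ∀ {f : TangentBundle 𝓘(ℝ, E) Q → ℝ}, f ∈ classK C ⊤ → DifferentiableAt ℝ
      (localHamiltonian C V.proj f) (tangentExtChart V.proj V) := fun hf ↦
    (contDiffAt_localHamiltonian hp hf).differentiableAt (by simp)
  have h2 : ∀ {f : TangentBundle 𝓘(ℝ, E) Q → ℝ}, f ∈ classK C ⊤ → ContDiffAt ℝ 2
      (localReading V.proj f) (tangentExtChart V.proj V) := fun hf ↦
    (contDiffAt_localReading_of_mem_classK hp hf).of_le (by simpa using ENat.LEInfty.out)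
  exact (isHamiltonianAt_localReading hp hf).jacobi (isHamiltonianAt_localReading hp hg)
    (isHamiltonianAt_localReading hp hh) ((contDiffAt_localForm hp).differentiableAt (by simp))
    (hX hf) (hX hg) (hX hh) (h2 hf) (h2 hg) (h2 hh)
    (Filter.Eventually.of_forall fun q ↦ extDerivOne_antisymm _ q) (localForm_closed hp)

/-! ### The Lie algebra structure on `𝒦(TQ)`. -/

variable (C) in
/-- The bracket as a bilinear map on `𝒦(TQ)`. -/
def poissonBracketHom : classK C ⊤ →ₗ[ℝ] classK C ⊤ →ₗ[ℝ] classK C ⊤ :=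
  LinearMap.mk₂ ℝ
    (fun f g ↦ ⟨poissonBracket C f g, poissonBracket_mem_classK f.2 g.2⟩)
    (fun f₁ f₂ g ↦ Subtype.ext (by
      simpa using poissonBracket_linearCombination_left (g := g) f₁.2 f₂.2 1 1))
    -- Homogeneity is the linear combination `c • f + 0 • f`.
    (fun c f g ↦ Subtype.ext (by
      simpa using poissonBracket_linearCombination_left (g := g) f.2 f.2 c 0))
    (fun g f₁ f₂ ↦ Subtype.ext (by
      simpa using poissonBracket_linearCombination_right (g := g) f₁.2 f₂.2 1 1))
    (fun c g f ↦ Subtype.ext (by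
      simpa using poissonBracket_linearCombination_right (g := g) f.2 f.2 c 0))

theorem poissonBracketHom_jacobi (f g h : classK C ⊤) :
    poissonBracketHom C f (poissonBracketHom C g h) +
      poissonBracketHom C g (poissonBracketHom C h f) +
        poissonBracketHom C h (poissonBracketHom C f g) = 0 := by
  refine Subtype.ext ?_
  change poissonBracket C f (poissonBracket C g h) + poissonBracket C g (poissonBracket C h f) +
    poissonBracket C h (poissonBracket C f g) = 0
  rw [poissonBracket_antisymm C f (poissonBracket C g h),
    poissonBracket_antisymm C g (poissonBracket C h f),
    poissonBracket_antisymm C (h : TangentBundle 𝓘(ℝ, E) Q → ℝ) (poissonBracket C f g), ← neg_add, ← neg_add, neg_eq_zero]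
  exact poissonBracket_jacobi g.2 h.2 f.2

end Bracket

end WeakRiem

end

theorem mainTheorem7 {E : Type*} [NormedAddCommGroup E] [NormedSpace ℝ E] [CompleteSpace E]
    {Q : Type*} [TopologicalSpace Q] [ChartedSpace E Q] [IsManifold 𝓘(ℝ, E) ∞ Q]
    (m : WeakRiem.WeakRiemannianMetric E Q) (C : WeakRiem.RiemannianConnection m)
    (hm : m.DenseInclusion) :
    -- antisymmetry, bilinearity and the derivation property on each class `𝒦^k(TQ)`
    (∀ k : ℕ∞,
      (∀ f ∈ WeakRiem.classK C k, ∀ g ∈ WeakRiem.classK C k,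
        WeakRiem.poissonBracket C f g = - WeakRiem.poissonBracket C g f) ∧
      (∀ f₁ ∈ WeakRiem.classK C k, ∀ f₂ ∈ WeakRiem.classK C k, ∀ g ∈ WeakRiem.classK C k,
        ∀ a b : ℝ,
        WeakRiem.poissonBracket C (a • f₁ + b • f₂) g =
            a • WeakRiem.poissonBracket C f₁ g + b • WeakRiem.poissonBracket C f₂ g ∧
        WeakRiem.poissonBracket C g (a • f₁ + b • f₂) =
            a • WeakRiem.poissonBracket C g f₁ + b • WeakRiem.poissonBracket C g f₂) ∧
      (∀ f₁ ∈ WeakRiem.classK C k, ∀ f₂ ∈ WeakRiem.classK C k, ∀ g ∈ WeakRiem.classK C k,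
        WeakRiem.poissonBracket C (f₁ * f₂) g =
            f₁ * WeakRiem.poissonBracket C f₂ g + f₂ * WeakRiem.poissonBracket C f₁ g ∧
        WeakRiem.poissonBracket C g (f₁ * f₂) =
            f₁ * WeakRiem.poissonBracket C g f₂ + f₂ * WeakRiem.poissonBracket C g f₁)) ∧
    -- the bracket makes the real vector space `𝒦(TQ) = 𝒦^∞(TQ)` into a Lie algebra
    ∃ L : WeakRiem.classK C ⊤ →ₗ[ℝ] WeakRiem.classK C ⊤ →ₗ[ℝ] WeakRiem.classK C ⊤,
      (∀ f g, (L f g : TangentBundle 𝓘(ℝ, E) Q → ℝ) = WeakRiem.poissonBracket C f g) ∧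
      (∀ f, L f f = 0) ∧
      (∀ f g h, L f (L g h) + L g (L h f) + L h (L f g) = 0) := by
  refine ⟨fun k ↦ ⟨fun f _ g _ ↦ WeakRiem.poissonBracket_antisymm C f g,
    fun f₁ hf₁ f₂ hf₂ g _ a b ↦ ⟨WeakRiem.poissonBracket_linearCombination_left hf₁ hf₂ a b,
      WeakRiem.poissonBracket_linearCombination_right hf₁ hf₂ a b⟩,
    fun f₁ hf₁ f₂ hf₂ g _ ↦ ⟨WeakRiem.poissonBracket_mul_left hf₁ hf₂,
      WeakRiem.poissonBracket_mul_right hf₁ hf₂⟩⟩,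
    WeakRiem.poissonBracketHom C, fun f g ↦ rfl, fun f ↦ Subtype.ext ?_,
    WeakRiem.poissonBracketHom_jacobi⟩
  exact self_eq_neg.1 (WeakRiem.poissonBracket_antisymm C f f)
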